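/- Consider the $(1+2)$-dimensional degenerate Burgers equation \[ u_t+uu_x-u_{yy}=0 \qquad (*) \] for $u=u(t,x,y)$, with left-hand side $L:=u_t+uu_x-u_{yy}$. A differential function is a smooth real-valued function of $(t,x,y)\in\mathbb R^3$, $u$ and finitely many derivatives of $u$, defined on the whole jet space $\mathrm J^\infty(\mathbb R^3\times\mathbb R)$; $\mathrm D_t,\mathrm D_x,\mathrm D_y$ denote the total derivatives; and "on the solutions of $(*)$" means on the subset of the jet space that is defined by $(*)$ and all its differential consequences. A cosymmetry of $(*)$ is a differential function $\gamma$ with $\mathrm D_t\gamma+u\mathrm D_x\gamma+\mathrm D_y^2\gamma=0$ on the solutions of $(*)$. A conservation-law characteristic of $(*)$ is a differential function $\gamma$ such that $\gamma L=\mathrm D_tF^t+\mathrm D_xF^x+\mathrm D_yF^y$ identically on the jet space for some differential functions $F^t,F^x,F^y$. A cosymmetry or a conservation-law characteristic is trivial if it vanishes on the solutions of $(*)$. A conserved current of $(*)$ is a triple $F=(F^t,F^x,F^y)$ of differential functions with $\mathrm D_tF^t+\mathrm D_xF^x+\mathrm D_yF^y=0$ on the solutions of $(*)$; it is trivial if it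 is the sum of a triple that vanishes on the solutions of $(*)$ and a triple whose total divergence vanishes identically. The space of local conservation laws of $(*)$ is the quotient space of conserved currents by trivial ones. Let $\mathcal H$ be the space of smooth solutions $\gamma=\gamma(t,y)$, $(t,y)\in\mathbb R^2$, of the backward heat equation $\gamma_t+\gamma_{yy}=0$. 1. Each $\gamma\in\mathcal H$, regarded as a differential function, is a cosymmetry of $(*)$, and the map sending $\gamma$ to its coset is a linear isomorphism of $\mathcal H$ onto the quotient space of cosymmetries of $(*)$ by trivial ones. 2. Each $\gamma\in\mathcal H$, regarded as a differential function, is a conservation-law characteristic of $(*)$, and the map sending $\gamma$ to its coset is a linear isomorphism of $\mathcal H$ onto the quotient space of conservation-law characteristics of $(*)$ by trivial ones. 3. Each triple of the form \[ \bigl(\gamma u,\ \tfrac12\gamma u^2,\ \gamma_yu-\gamma u_y\bigr),\qquad \gamma\in\mathcal H, \] is a conserved current of $(*)$, and the map sending such a triple to its coset is a linear isomorphism of the space of these triples onto the space of local conservation laws of $(*)$. -/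

import Mathlib

open scoped ContDiff

noncomputable section

namespace DegenerateBurgers

/-! ### The jet space and differential functions -/

/-- Labels of the coordinates of the jet space `J^∞(ℝ³ × ℝ)`: `Sum.inl μ` labels the independent
variable `z_μ`, where `(z_0, z_1, z_2) = (t, x, y)`, and `Sum.inr α` labels the jet variable `u_α`,
which stands for the derivative of `u` of order `α = (α_0, α_1, α_2)`. -/
abbrev JetIndex : Type := Fin 3 ⊕ (Fin 3 → ℕ)

/-- Points of the infinite jet space. -/
abbrev Jet : Type := JetIndex → ℝ

/-- `f` is a smooth function of a finite number of the jet coordinates. -/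
def IsDiffFun (f : Jet → ℝ) : Prop :=
  ∃ S : Finset JetIndex, ∃ g : (S → ℝ) → ℝ, ContDiff ℝ ∞ g ∧ ∀ p : Jet, f p = g (fun i => p i)

/-- The partial derivative with respect to the jet coordinate labelled `i`. -/
def partialFun (i : JetIndex) (f : Jet → ℝ) : Jet → ℝ :=
  fun p => deriv (fun s => f (Function.update p i s)) (p i)

/-- The total derivative `D_μ = ∂_μ + ∑_α u_{α+ε_μ} ∂_{u_α}`; only finitely many terms of the sum
are nonzero if `f` is a differential function. -/
def totalDerivFun (μ : Fin 3) (f : Jet → ℝ) : Jet → ℝ :=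
  fun p => partialFun (Sum.inl μ) f p
    + ∑ᶠ α : Fin 3 → ℕ, p (Sum.inr (α + Pi.single μ 1)) * partialFun (Sum.inr α) f p

theorem IsDiffFun.exists_superset {f : Jet → ℝ} {S T : Finset JetIndex} (hST : S ⊆ T)
    {g : (S → ℝ) → ℝ} (hg : ContDiff ℝ ∞ g) (hf : ∀ p : Jet, f p = g (fun i => p i)) :
    ∃ g' : (T → ℝ) → ℝ, ContDiff ℝ ∞ g' ∧ ∀ p : Jet, f p = g' (fun i => p i) := by
  refine ⟨fun v => g (fun i => v ⟨i, hST i.2⟩), ?_, fun p => hf p⟩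
  exact hg.comp (contDiff_pi.2 fun i => contDiff_apply ℝ ℝ _)

theorem isDiffFun_const (c : ℝ) : IsDiffFun (fun _ => c) :=
  ⟨∅, fun _ => c, contDiff_const, fun _ => rfl⟩

theorem isDiffFun_coord (i : JetIndex) : IsDiffFun (fun p => p i) :=
  ⟨{i}, fun v => v ⟨i, by simp⟩, contDiff_apply ℝ ℝ _, fun _ => rfl⟩

theorem IsDiffFun.add {f g : Jet → ℝ} (hf : IsDiffFun f) (hg : IsDiffFun g) :
    IsDiffFun (f + g) := by
  classical
  obtain ⟨S, F, hF, hfF⟩ := hf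
  obtain ⟨T, G, hG, hgG⟩ := hg
  obtain ⟨F', hF', hfF'⟩ := exists_superset (Finset.subset_union_left (s₂ := T)) hF hfF
  obtain ⟨G', hG', hgG'⟩ := exists_superset (Finset.subset_union_right (s₁ := S)) hG hgG
  exact ⟨S ∪ T, fun v => F' v + G' v, hF'.add hG', fun p => by simp [hfF', hgG']⟩

theorem IsDiffFun.mul {f g : Jet → ℝ} (hf : IsDiffFun f) (hg : IsDiffFun g) :
    IsDiffFun (f * g) := by
  classical
  obtain ⟨S, F, hF, hfF⟩ := hf
  obtain ⟨T, G, hG, hgG⟩ := hg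
  obtain ⟨F', hF', hfF'⟩ := exists_superset (Finset.subset_union_left (s₂ := T)) hF hfF
  obtain ⟨G', hG', hgG'⟩ := exists_superset (Finset.subset_union_right (s₁ := S)) hG hgG
  exact ⟨S ∪ T, fun v => F' v * G' v, hF'.mul hG', fun p => by simp [hfF', hgG']⟩

/-- The differential functions of `u`, as a subalgebra of the algebra of all functions on the jet
space. -/
def diffFunAlgebra : Subalgebra ℝ (Jet → ℝ) where
  carrier := {f | IsDiffFun f}
  mul_mem' := IsDiffFun.mul
  add_mem' := IsDiffFun.add
  algebraMap_mem' := isDiffFun_const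

/-- The type of differential functions of `u`, that is, of smooth real-valued functions on the
jet space that depend on finitely many jet coordinates. -/
def DiffFun : Type := diffFunAlgebra

instance : CommRing DiffFun := inferInstanceAs (CommRing diffFunAlgebra)

instance : Algebra ℝ DiffFun := inferInstanceAs (Algebra ℝ diffFunAlgebra)

instance : CoeFun DiffFun (fun _ => Jet → ℝ) := ⟨fun f => f.1⟩

@[ext]
theorem DiffFun.ext {f g : DiffFun} (h : ∀ p : Jet, f p = g p) : f = g := Subtype.ext (funext h)

theorem partialFun_eq_zero {f : Jet → ℝ} {S : Finset JetIndex} {g : (S → ℝ) → ℝ}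
    (hf : ∀ p : Jet, f p = g (fun i => p i)) {i : JetIndex} (hi : i ∉ S) (p : Jet) :
    partialFun i f p = 0 := by
  have h : (fun s => f (Function.update p i s)) = fun _ => f p := by
    funext s
    rw [hf, hf]
    congr 1
    funext j
    exact Function.update_of_ne (fun h => hi (by rw [← h]; exact j.2)) _ _
  simp [partialFun, h]

theorem hasDerivAt_diffFun_update {f : Jet → ℝ} {S : Finset JetIndex} {g : (S → ℝ) → ℝ}
    (hg : ContDiff ℝ ∞ g) (hf : ∀ p : Jet, f p = g (fun i => p i)) {i : JetIndex} (hi : i ∈ S)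
    (p : Jet) :
    HasDerivAt (fun s => f (Function.update p i s))
      (fderiv ℝ g (fun j => p j) (Pi.single ⟨i, hi⟩ 1)) (p i) := by
  classical
  have h : (fun s => f (Function.update p i s))
      = fun s => g (Function.update (fun j : S => p j) ⟨i, hi⟩ s) := by
    funext s
    rw [hf]
    congr 1
    funext j
    by_cases hj : j = ⟨i, hi⟩
    · subst hj; simp
    · rw [Function.update_of_ne hj, Function.update_of_ne (fun h => hj (Subtype.ext h))]
  rw [h]
  have h1 := hasDerivAt_update (fun j : S => p j) (⟨i, hi⟩ : S) (p i)
  have h2 : HasFDerivAt g (fderiv ℝ g (fun j : S => p j))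
      (Function.update (fun j : S => p j) ⟨i, hi⟩ (p i)) := by
    have : Function.update (fun j : S => p j) ⟨i, hi⟩ (p i) = fun j : S => p j :=
      Function.update_eq_self (⟨i, hi⟩ : S) (fun j : S => p j)
    rw [this]
    exact (hg.differentiable (by simp)).differentiableAt.hasFDerivAt
  exact h2.comp_hasDerivAt (p i) h1

theorem IsDiffFun.differentiableAt_update {f : Jet → ℝ} (hf : IsDiffFun f) (i : JetIndex)
    (p : Jet) : DifferentiableAt ℝ (fun s => f (Function.update p i s)) (p i) := by
  classical
  obtain ⟨S, g, hg, hfg⟩ := hf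
  obtain ⟨g', hg', hfg'⟩ := exists_superset (Finset.subset_insert i S) hg hfg
  exact (hasDerivAt_diffFun_update hg' hfg' (Finset.mem_insert_self i S) p).differentiableAt

theorem IsDiffFun.partialFun {f : Jet → ℝ} (hf : IsDiffFun f) (i : JetIndex) :
    IsDiffFun (partialFun i f) := by
  classical
  obtain ⟨S, g, hg, hfg⟩ := hf
  obtain ⟨g', hg', hfg'⟩ := exists_superset (Finset.subset_insert i S) hg hfg
  refine ⟨insert i S,
    fun v => fderiv ℝ g' v (Pi.single ⟨i, Finset.mem_insert_self i S⟩ 1), ?_, fun p => ?_⟩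
  · exact (hg'.fderiv_right (m := ∞) (by simp)).clm_apply contDiff_const
  · exact (hasDerivAt_diffFun_update hg' hfg' (Finset.mem_insert_self i S) p).deriv

/-- The partial derivative as a linear operator on differential functions. -/
def partialD (i : JetIndex) : Module.End ℝ DiffFun where
  toFun f := ⟨partialFun i f.1, IsDiffFun.partialFun f.2 i⟩
  map_add' f g := by
    ext p
    exact deriv_add (IsDiffFun.differentiableAt_update f.2 i p)
      (IsDiffFun.differentiableAt_update g.2 i p)
  map_smul' c f := by
    ext p
    exact deriv_const_smul c (IsDiffFun.differentiableAt_update f.2 i p)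

theorem IsDiffFun.finite_support {f : Jet → ℝ} (hf : IsDiffFun f) :
    {α : Fin 3 → ℕ | ∃ p, DegenerateBurgers.partialFun (Sum.inr α) f p ≠ 0}.Finite := by
  obtain ⟨S, g, -, hfg⟩ := hf
  refine (S.finite_toSet.preimage (f := Sum.inr) Sum.inr_injective.injOn).subset ?_
  rintro α ⟨p, hp⟩
  by_contra h
  exact hp (partialFun_eq_zero hfg h p)

theorem IsDiffFun.totalDerivFun_eq_sum {f : Jet → ℝ} (μ : Fin 3) {S : Finset (Fin 3 → ℕ)}
    (hS : {α : Fin 3 → ℕ | ∃ p, DegenerateBurgers.partialFun (Sum.inr α) f p ≠ 0} ⊆ S) (p : Jet) :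
    totalDerivFun μ f p = DegenerateBurgers.partialFun (Sum.inl μ) f p
      + ∑ α ∈ S, p (Sum.inr (α + Pi.single μ 1))
          * DegenerateBurgers.partialFun (Sum.inr α) f p := by
  rw [totalDerivFun, finsum_eq_sum_of_support_subset]
  intro α hα
  exact hS ⟨p, right_ne_zero_of_mul hα⟩

theorem IsDiffFun.totalDerivFun {f : Jet → ℝ} (hf : IsDiffFun f) (μ : Fin 3) :
    IsDiffFun (totalDerivFun μ f) := by
  have h : DegenerateBurgers.totalDerivFun μ f = DegenerateBurgers.partialFun (Sum.inl μ) f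
      + ∑ α ∈ hf.finite_support.toFinset, (fun p : Jet => p (Sum.inr (α + Pi.single μ 1)))
          * DegenerateBurgers.partialFun (Sum.inr α) f := by
    funext p
    rw [IsDiffFun.totalDerivFun_eq_sum μ (S := hf.finite_support.toFinset) (by simp) p]
    simp
  rw [h]
  exact diffFunAlgebra.add_mem (hf.partialFun _) (diffFunAlgebra.sum_mem fun α _ =>
    diffFunAlgebra.mul_mem (isDiffFun_coord _) (hf.partialFun _))

/-- The total derivative `D_μ` as a linear operator on differential functions. -/
def totalD (μ : Fin 3) : Module.End ℝ DiffFun where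
  toFun f := ⟨totalDerivFun μ f.1, IsDiffFun.totalDerivFun f.2 μ⟩
  map_add' f g := by
    classical
    ext p
    have hf := IsDiffFun.finite_support f.2
    have hg := IsDiffFun.finite_support g.2
    have hs : ∀ i : JetIndex, partialFun i (f + g : DiffFun).1
        = partialFun i f.1 + partialFun i g.1 := fun i =>
      congrArg Subtype.val ((partialD i).map_add f g)
    change totalDerivFun μ (f + g : DiffFun).1 p
      = totalDerivFun μ f.1 p + totalDerivFun μ g.1 p
    rw [IsDiffFun.totalDerivFun_eq_sum μ (S := hf.toFinset ∪ hg.toFinset) _ p,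
      IsDiffFun.totalDerivFun_eq_sum μ (S := hf.toFinset ∪ hg.toFinset) _ p,
      IsDiffFun.totalDerivFun_eq_sum μ (S := hf.toFinset ∪ hg.toFinset) _ p]
    · simp only [hs, Pi.add_apply, mul_add, Finset.sum_add_distrib]
      ring
    · intro α hα; simpa using Or.inr hα
    · intro α hα; simpa using Or.inl hα
    · rintro α ⟨q, hq⟩
      rw [hs, Pi.add_apply] at hq
      by_cases h : partialFun (Sum.inr α) f.1 q = 0
      · rw [h, zero_add] at hq
        simpa using Or.inr ⟨q, hq⟩
      · simpa using Or.inl ⟨q, h⟩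
  map_smul' c f := by
    ext p
    have hs : ∀ i : JetIndex, partialFun i (c • f : DiffFun).1
        = c • partialFun i f.1 := fun i =>
      congrArg Subtype.val ((partialD i).map_smul c f)
    change totalDerivFun μ (c • f : DiffFun).1 p = c * totalDerivFun μ f.1 p
    have hf := IsDiffFun.finite_support f.2
    rw [IsDiffFun.totalDerivFun_eq_sum μ (S := hf.toFinset) _ p,
      IsDiffFun.totalDerivFun_eq_sum μ (S := hf.toFinset) (by simp) p]
    · simp only [hs, Pi.smul_apply, smul_eq_mul, mul_add, Finset.mul_sum]
      congr 1
      exact Finset.sum_congr rfl fun α _ => by ring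
    · rintro α ⟨q, hq⟩
      rw [hs, Pi.smul_apply] at hq
      simpa using ⟨q, right_ne_zero_of_mul hq⟩

/-- The iterated total derivative `D^α = D_0^{α_0} D_1^{α_1} D_2^{α_2}`. -/
def totalDIter (α : Fin 3 → ℕ) : Module.End ℝ DiffFun :=
  totalD 0 ^ α 0 * totalD 1 ^ α 1 * totalD 2 ^ α 2

/-- The jet variable `u_α` as a differential function. -/
def jetVar (α : Fin 3 → ℕ) : DiffFun := ⟨fun p => p (Sum.inr α), isDiffFun_coord _⟩

/-! ### The degenerate Burgers equation -/

/-- The left-hand side of the equation `u_t + u u_x - u_yy = 0`. -/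
def burgers : DiffFun :=
  jetVar ![1, 0, 0] + jetVar ![0, 0, 0] * jetVar ![0, 1, 0] - jetVar ![0, 0, 2]

/-- The manifold in the jet space that is defined by the equation and all its differential
consequences. -/
def solutionManifold : Set Jet :=
  {p | ∀ α : Fin 3 → ℕ, totalDIter α burgers p = 0}

/-- The differential functions vanishing on the solutions of the equation. -/
def vanishing : Submodule ℝ DiffFun where
  carrier := {f | ∀ p ∈ solutionManifold, f p = 0}
  zero_mem' := fun _ _ => rfl
  add_mem' := fun {f g} hf hg p hp => by
    change f p + g p = 0
    rw [hf p hp, hg p hp, add_zero]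
  smul_mem' := fun c f hf p hp => by
    change c * f p = 0
    rw [hf p hp, mul_zero]

/-- The operator `γ ↦ D_t γ + u D_x γ + D_y² γ`, which is, up to sign, the formal adjoint of the
linearization of the left-hand side of the equation. -/
def cosymmetryOp : Module.End ℝ DiffFun :=
  totalD 0 + LinearMap.mulLeft ℝ (jetVar ![0, 0, 0]) ∘ₗ totalD 1 + totalD 2 ∘ₗ totalD 2

/-- The cosymmetries of the equation: differential functions `γ` such that
`D_t γ + u D_x γ + D_y² γ` vanishes on the solutions of the equation. -/
def cosymmetries : Submodule ℝ DiffFun := vanishing.comap cosymmetryOp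

/-- Triples of differential functions `(F^t, F^x, F^y)`. -/
abbrev Current : Type := Fin 3 → DiffFun

/-- The total divergence `D_t F^t + D_x F^x + D_y F^y`. -/
def totalDiv : Current →ₗ[ℝ] DiffFun :=
  ∑ μ : Fin 3, totalD μ ∘ₗ LinearMap.proj μ

/-- The conservation-law characteristics of the equation: differential functions `γ` such that
the product of `γ` and the left-hand side of the equation is, identically on the jet space,
a total divergence. -/
def characteristics : Submodule ℝ DiffFun :=
  (LinearMap.range totalDiv).comap (LinearMap.mulRight ℝ burgers)

/-- The conserved currents of the equation: triples whose total divergence vanishes on the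
solutions. -/
def conservedCurrents : Submodule ℝ Current := vanishing.comap totalDiv

/-- The trivial currents: sums of a triple vanishing on the solutions and a null divergence, that
is, a triple whose total divergence vanishes identically. -/
def trivialCurrents : Submodule ℝ Current :=
  Submodule.pi Set.univ (fun _ => vanishing) ⊔ LinearMap.ker totalDiv

/-- Cosymmetries modulo the trivial ones, that is, those vanishing on the solutions. -/
abbrev CosymmetryClasses : Type := cosymmetries ⧸ vanishing.submoduleOf cosymmetries

/-- Conservation-law characteristics modulo the trivial ones, that is, those vanishing on the
solutions. -/
abbrev CharacteristicClasses : Type := characteristics ⧸ vanishing.submoduleOf characteristics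

/-- The space of local conservation laws: conserved currents modulo the trivial ones. -/
abbrev ConservationLaws : Type := conservedCurrents ⧸ trivialCurrents.submoduleOf conservedCurrents

/-! ### The backward heat equation -/

theorem two_le_smooth : ((2 : ℕ) : WithTop ℕ∞) ≤ ∞ := by
  exact WithTop.coe_le_coe.2 le_top

/-- The space of smooth solutions `γ = γ(t, y)` of the backward heat equation
`γ_t + γ_yy = 0`. -/
def backwardHeat : Submodule ℝ (ℝ × ℝ → ℝ) where
  carrier := {γ | ContDiff ℝ ∞ γ ∧ ∀ t y : ℝ,
    deriv (fun s => γ (s, y)) t + iteratedDeriv 2 (fun s => γ (t, s)) y = 0}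
  zero_mem' := by
    refine ⟨contDiff_const, fun t y => ?_⟩
    simp
  add_mem' := by
    rintro f g ⟨hf, hf'⟩ ⟨hg, hg'⟩
    refine ⟨hf.add hg, fun t y => ?_⟩
    have h1 : ∀ h : ℝ × ℝ → ℝ, ContDiff ℝ ∞ h → ContDiff ℝ ∞ (fun s => h (s, y)) :=
      fun h hh => hh.comp (contDiff_id.prodMk contDiff_const)
    have h2 : ∀ h : ℝ × ℝ → ℝ, ContDiff ℝ ∞ h → ContDiff ℝ ∞ (fun s => h (t, s)) :=
      fun h hh => hh.comp (contDiff_const.prodMk contDiff_id)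
    have e1 : deriv (fun s => (f + g) (s, y)) t
        = deriv (fun s => f (s, y)) t + deriv (fun s => g (s, y)) t :=
      deriv_add ((h1 f hf).differentiable (by simp) t) ((h1 g hg).differentiable (by simp) t)
    have e2 : iteratedDeriv 2 (fun s => (f + g) (t, s)) y
        = iteratedDeriv 2 (fun s => f (t, s)) y + iteratedDeriv 2 (fun s => g (t, s)) y :=
      iteratedDeriv_add ((h2 f hf).of_le two_le_smooth).contDiffAt
        ((h2 g hg).of_le two_le_smooth).contDiffAt
    rw [e1, e2]
    linarith [hf' t y, hg' t y]
  smul_mem' := by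
    rintro c f ⟨hf, hf'⟩
    refine ⟨hf.const_smul c, fun t y => ?_⟩
    have h1 : ContDiff ℝ ∞ (fun s => f (s, y)) := hf.comp (contDiff_id.prodMk contDiff_const)
    have h2 : ContDiff ℝ ∞ (fun s => f (t, s)) := hf.comp (contDiff_const.prodMk contDiff_id)
    have e1 : deriv (fun s => (c • f) (s, y)) t = c * deriv (fun s => f (s, y)) t :=
      deriv_const_smul c (h1.differentiable (by simp) t)
    have e2 : iteratedDeriv 2 (fun s => (c • f) (t, s)) y
        = c * iteratedDeriv 2 (fun s => f (t, s)) y :=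
      iteratedDeriv_const_smul_field c _
    rw [e1, e2, ← mul_add, hf' t y, mul_zero]

theorem isDiffFun_of_contDiff {γ : ℝ × ℝ → ℝ} (hγ : ContDiff ℝ ∞ γ) :
    IsDiffFun (fun p => γ (p (Sum.inl 0), p (Sum.inl 2))) :=
  ⟨{Sum.inl 0, Sum.inl 2}, fun v => γ (v ⟨Sum.inl 0, by simp⟩, v ⟨Sum.inl 2, by simp⟩),
    hγ.comp ((contDiff_apply ℝ ℝ _).prodMk (contDiff_apply ℝ ℝ _)), fun _ => rfl⟩

/-- A solution `γ = γ(t, y)` of the backward heat equation, regarded as a differential function. -/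
def heatToDiffFun : backwardHeat →ₗ[ℝ] DiffFun where
  toFun γ := ⟨fun p => (γ : ℝ × ℝ → ℝ) (p (Sum.inl 0), p (Sum.inl 2)),
    isDiffFun_of_contDiff γ.2.1⟩
  map_add' _ _ := rfl
  map_smul' _ _ := rfl

/-- The triple `(γ u, ½ γ u², γ_y u - γ u_y)`. -/
def heatCurrent : backwardHeat →ₗ[ℝ] Current where
  toFun γ := ![heatToDiffFun γ * jetVar ![0, 0, 0],
    (1 / 2 : ℝ) • (heatToDiffFun γ * jetVar ![0, 0, 0] ^ 2),
    partialD (Sum.inl 2) (heatToDiffFun γ) * jetVar ![0, 0, 0]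
      - heatToDiffFun γ * jetVar ![0, 0, 1]]
  map_add' γ δ := by
    funext μ
    fin_cases μ
    · simp [add_mul]
    · simp [add_mul]
    · simp only [map_add, add_mul, Fin.reduceFinMk, Matrix.cons_val, Pi.add_apply]
      abel
  map_smul' c γ := by
    funext μ
    fin_cases μ
    · simp
    · simp [smul_comm c]
    · simp [smul_sub]

/-- The space of the triples `(γ u, ½ γ u², γ_y u - γ u_y)`, where `γ = γ(t, y)` runs through
the solutions of the backward heat equation. -/
def heatCurrents : Submodule ℝ Current := LinearMap.range heatCurrent

end DegenerateBurgers

end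

open scoped ContDiff

noncomputable section

namespace DegenerateBurgers

/-! ### Evaluation, partial derivatives and the chain rule -/

/-! Solving the equation for u_t makes the derivatives of u in x and y alone free coordinates on the
solutions. Substitution of the t-derivatives, `restrictSol`, is pullback along a retraction onto the
solution manifold. Hence a function vanishes on the solutions iff its restriction is zero
(`mem_vanishing_iff`), and D_x, D_y keep their form while D_t becomes `evolutionD`
(`restrictSol_totalD`).

Cosymmetries. Let g be a restricted cosymmetry of order n in y. In the restricted condition, the
coefficient at the y-order n + 2 receives ∂g/∂u_α once from D_t, through u_t = u_yy + ..., and once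
from D_y², with the same sign. So 2 ∂g/∂u_α = 0, and descent on n leaves g = g(t,x,y)
(`vgrad_eq_zero_of_reducedCosymmetryOp`). What remains, g_t + u g_x + g_yy = 0, splits in u into g_x
= 0 and the backward heat equation.

Characteristics. The Euler operator kills total divergences, and on γL it gives minus the cosymmetry
operator applied to γ, up to the differential ideal of L. Hence characteristics are cosymmetries
(`characteristics_le_cosymmetries`). Conversely, γ in the heat space is a characteristic by means of
the explicit current (`totalDiv_heatCurrent`).

Conservation laws. Let ρ be the variational derivative, in x and y only, of the restricted density
of a conserved current. Integration by parts shows that ρL is a total divergence, so ρ = γ is a heat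
solution by the previous results. Then the density minus γu has zero variational derivative and is
therefore D_x A + D_y B (`exists_eq_totalD_add`). This can be removed by a null divergence, and a
conserved current whose density vanishes on the solutions is trivial. Independence of the classes
follows by the same variational derivative, which recovers γ from γu.

The Euler operators are handled through symbols: the linearization Σ (∂f/∂u_α) D^α of f is stored in
`vgrad`, composition with D_μ from the left is `symbolD`, and integration by parts is the remainder
`symbolRem`. -/

/-- Multi-indices of derivatives. -/
abbrev MultiIndex : Type := Fin 3 → ℕ

/-- Evaluation of differential functions at a point of the jet space. -/
def evalAt (p : Jet) : DiffFun →+* ℝ where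
  toFun f := f p
  map_one' := rfl
  map_mul' _ _ := rfl
  map_zero' := rfl
  map_add' _ _ := rfl

@[simp] theorem add_eval (f g : DiffFun) (p : Jet) : (f + g) p = f p + g p := rfl
@[simp] theorem sub_eval (f g : DiffFun) (p : Jet) : (f - g) p = f p - g p := rfl
@[simp] theorem mul_eval (f g : DiffFun) (p : Jet) : (f * g) p = f p * g p := rfl
@[simp] theorem zero_eval (p : Jet) : (0 : DiffFun) p = 0 := rfl
@[simp] theorem one_eval (p : Jet) : (1 : DiffFun) p = 1 := rfl
@[simp] theorem smul_eval (c : ℝ) (f : DiffFun) (p : Jet) : (c • f) p = c * f p := rfl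
@[simp] theorem jetVar_eval (α : MultiIndex) (p : Jet) : jetVar α p = p (Sum.inr α) := rfl

theorem sum_eval {ι : Type*} (s : Finset ι) (f : ι → DiffFun) (p : Jet) :
    (∑ i ∈ s, f i) p = ∑ i ∈ s, f i p :=
  map_sum (evalAt p) f s

/-- The independent variable `z_μ` as a differential function. -/
def baseVar (μ : Fin 3) : DiffFun := ⟨fun p => p (Sum.inl μ), isDiffFun_coord _⟩

@[simp] theorem baseVar_eval (μ : Fin 3) (p : Jet) : baseVar μ p = p (Sum.inl μ) := rfl

theorem partialD_eval (i : JetIndex) (f : DiffFun) (p : Jet) :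
    partialD i f p = deriv (fun s => f (Function.update p i s)) (p i) := rfl

theorem hasDerivAt_update_partialD (i : JetIndex) (f : DiffFun) (p : Jet) :
    HasDerivAt (fun s => f (Function.update p i s)) (partialD i f p) (p i) :=
  (IsDiffFun.differentiableAt_update f.2 i p).hasDerivAt

/-- The derivative with respect to the jet variables, as a finitely supported family. -/
def vgrad : DiffFun →ₗ[ℝ] MultiIndex →₀ DiffFun where
  toFun f := Finsupp.ofSupportFinite (fun α => partialD (Sum.inr α) f) <| by
    refine (IsDiffFun.finite_support f.2).subset fun α hα => ?_
    by_contra h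
    refine hα (DiffFun.ext fun p => ?_)
    by_contra hp
    exact h ⟨p, hp⟩
  map_add' f g := by ext1 α; exact map_add (partialD (Sum.inr α)) f g
  map_smul' c f := by ext1 α; exact map_smul (partialD (Sum.inr α)) c f

@[simp] theorem vgrad_apply (f : DiffFun) (α : MultiIndex) :
    vgrad f α = partialD (Sum.inr α) f := rfl

/-- A differential function can be written as a smooth function of the independent variables and of
finitely many jet variables containing those in a given finite set. -/
theorem DiffFun.exists_rep (f : DiffFun) :
    ∃ T : Finset MultiIndex, ∃ g : (↥(Finset.univ.disjSum T : Finset JetIndex) → ℝ) → ℝ,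
      ContDiff ℝ ∞ g ∧ ∀ p : Jet, f p = g (fun i => p i) := by
  obtain ⟨S, g, hg, hf⟩ := f.2
  refine ⟨S.toRight, IsDiffFun.exists_superset (S := S) ?_ hg hf⟩
  rintro (μ | α) h
  · simp
  · simpa using h

/-- Chain rule along a curve that is differentiable only coordinate by coordinate. No topology on
the infinite jet space is needed, since f factors through finitely many coordinates. -/
theorem DiffFun.hasDerivAt_comp (f : DiffFun) {c : ℝ → Jet} {v : Jet} {s : ℝ}
    (hc : ∀ i, HasDerivAt (fun r => c r i) (v i) s) :
    HasDerivAt (fun r => f (c r))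
      (∑ μ, v (Sum.inl μ) * partialD (Sum.inl μ) f (c s)
        + (vgrad f).sum fun α a => v (Sum.inr α) * a (c s)) s := by
  classical
  obtain ⟨T, g, hg, hf⟩ := f.exists_rep
  have h1 : HasFDerivAt g (fderiv ℝ g (fun i => c s i)) (fun i => c s i) :=
    (hg.differentiable (by simp)).differentiableAt.hasFDerivAt
  have h2 : HasDerivAt (fun r => fun i : ↥(Finset.univ.disjSum T : Finset JetIndex) => c r i)
      (fun i => v i) s := hasDerivAt_pi.2 fun i => hc i
  have h3 := h1.comp_hasDerivAt s h2
  have e : (fun r => f (c r))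
      = g ∘ fun r => fun i : ↥(Finset.univ.disjSum T : Finset JetIndex) => c r i := by
    funext r; exact hf _
  rw [e]
  refine h3.congr_deriv ?_
  have h4 : ∀ i : ↥(Finset.univ.disjSum T : Finset JetIndex),
      fderiv ℝ g (fun i => c s i) (Pi.single i 1) = partialD i f (c s) := fun i =>
    ((hasDerivAt_diffFun_update hg hf i.2 (c s)).deriv).symm
  rw [← Finset.univ_sum_single fun i : ↥(Finset.univ.disjSum T : Finset JetIndex) => v i, map_sum]
  have h5 : ∀ i : ↥(Finset.univ.disjSum T : Finset JetIndex),
      fderiv ℝ g (fun i => c s i) (Pi.single i (v i)) = v i * partialD i f (c s) := fun i => by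
    rw [← h4, ← smul_eq_mul, ← map_smul, ← Pi.single_smul, smul_eq_mul, mul_one]
  simp only [h5]
  symm
  rw [Finset.sum_coe_sort (Finset.univ.disjSum T) (fun i => v i * partialD i f (c s)),
    Finset.sum_disjSum, Finsupp.sum_of_support_subset (s := T)]
  · rfl
  · intro α hα
    by_contra h
    refine (Finsupp.mem_support_iff.1 hα) (DiffFun.ext fun p => ?_)
    exact partialFun_eq_zero hf (by simpa using h) p
  · simp

theorem DiffFun.contDiff_comp (f : DiffFun) {E : Type*} [NormedAddCommGroup E] [NormedSpace ℝ E]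
    {c : E → Jet} (hc : ∀ i, ContDiff ℝ ∞ fun r => c r i) : ContDiff ℝ ∞ fun r => f (c r) := by
  obtain ⟨S, g, hg, hf⟩ := f.2
  have e : (fun r => f (c r)) = g ∘ fun r => fun i : S => c r i := by
    funext r; exact hf _
  rw [e]
  exact hg.comp (contDiff_pi.2 fun i => hc i)

/-- Differential functions may be substituted into a smooth function of finitely many variables. -/
theorem isDiffFun_comp {ι : Type*} [Fintype ι] {g : (ι → ℝ) → ℝ} (hg : ContDiff ℝ ∞ g)
    (R : ι → DiffFun) : IsDiffFun fun p => g fun i => R i p := by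
  classical
  choose S G hG hf using fun i => (R i).2
  have hS : ∀ i, S i ⊆ Finset.univ.biUnion S := fun i => Finset.subset_biUnion_of_mem S (by simp)
  choose G' hG' hf' using fun i => IsDiffFun.exists_superset (hS i) (hG i) (hf i)
  refine ⟨Finset.univ.biUnion S, fun v => g fun i => G' i v,
    hg.comp (contDiff_pi.2 fun i => hG' i), fun p => ?_⟩
  exact congrArg g (funext fun i => hf' i p)

theorem partialD_comm (i j : JetIndex) (f : DiffFun) :
    partialD i (partialD j f) = partialD j (partialD i f) := by
  classical
  obtain ⟨S, g₀, hg₀, hf₀⟩ := f.2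
  -- With both indices in one finite set, the mixed partials are values of the second derivative of
  -- a single smooth function, which is symmetric.
  obtain ⟨T, hS, hi, hj⟩ : ∃ T, S ⊆ T ∧ i ∈ T ∧ j ∈ T :=
    ⟨insert i (insert j S), (Finset.subset_insert j S).trans (Finset.subset_insert i _),
      by simp, by simp⟩
  obtain ⟨g, hg, hf⟩ := IsDiffFun.exists_superset hS hg₀ hf₀
  have key : ∀ (k l : JetIndex) (hk : k ∈ T) (hl : l ∈ T) (p : Jet), partialD k (partialD l f) p
      = fderiv ℝ (fderiv ℝ g) (fun m => p m) (Pi.single ⟨k, hk⟩ 1) (Pi.single ⟨l, hl⟩ 1) := by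
    intro k l hk hl p
    have h1 : ∀ q : Jet, partialD l f q = fderiv ℝ g (fun m => q m) (Pi.single ⟨l, hl⟩ 1) :=
      fun q => (hasDerivAt_diffFun_update hg hf hl q).deriv
    have hg' : ContDiff ℝ ∞ (fderiv ℝ g) := hg.fderiv_right (by simp)
    have h2 : ContDiff ℝ ∞ fun v => fderiv ℝ g v (Pi.single ⟨l, hl⟩ 1) :=
      hg'.clm_apply contDiff_const
    refine (hasDerivAt_diffFun_update h2 h1 hk p).deriv.trans ?_
    rw [fderiv_clm_apply ((hg'.differentiable (by simp)) _) (differentiableAt_const _)]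
    simp
  ext p
  rw [key i j hi hj, key j i hj hi]
  exact ((hg.contDiffAt (x := fun m : T => p m)).isSymmSndFDerivAt
    (by simpa using two_le_smooth)) _ _

theorem partialD_mul (i : JetIndex) (f g : DiffFun) :
    partialD i (f * g) = partialD i f * g + f * partialD i g := by
  ext p
  have h := ((hasDerivAt_update_partialD i f p).mul (hasDerivAt_update_partialD i g p)).deriv
  simp only [Function.update_eq_self] at h
  exact h

theorem partialD_jetVar (α β : MultiIndex) :
    partialD (Sum.inr α) (jetVar β) = if β = α then 1 else 0 := by
  ext p
  rw [partialD_eval]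
  split_ifs with h
  · subst h; simp
  · have : ∀ s, Function.update p (Sum.inr α) s (Sum.inr β) = p (Sum.inr β) := fun s =>
      Function.update_of_ne (by simpa using h) _ _
    simp [this]

theorem partialD_inl_jetVar (μ : Fin 3) (β : MultiIndex) :
    partialD (Sum.inl μ) (jetVar β) = 0 := by
  ext p
  simp [partialD_eval]

theorem partialD_baseVar (μ ν : Fin 3) :
    partialD (Sum.inl μ) (baseVar ν) = if ν = μ then 1 else 0 := by
  ext p
  rw [partialD_eval]
  split_ifs with h
  · subst h; simp
  · have : ∀ s, Function.update p (Sum.inl μ) s (Sum.inl ν) = p (Sum.inl ν) := fun s =>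
      Function.update_of_ne (by simpa using h) _ _
    simp [this]

theorem partialD_inr_baseVar (α : MultiIndex) (ν : Fin 3) :
    partialD (Sum.inr α) (baseVar ν) = 0 := by
  ext p
  simp [partialD_eval]

theorem vgrad_mul (f g : DiffFun) : vgrad (f * g) = g • vgrad f + f • vgrad g := by
  ext1 α
  simp [partialD_mul, mul_comm]

theorem vgrad_jetVar (β : MultiIndex) : vgrad (jetVar β) = Finsupp.single β 1 := by
  ext1 α
  rw [vgrad_apply, partialD_jetVar, Finsupp.single_apply]

/-- A differential function whose partial derivatives with respect to the coordinates outside a set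
vanish is a function of the coordinates in this set. -/
theorem DiffFun.eq_of_partialD_eq_zero {f : DiffFun} {I : Set JetIndex}
    (hf : ∀ i ∉ I, partialD i f = 0) {p q : Jet} (hpq : ∀ i ∈ I, p i = q i) : f p = f q := by
  classical
  obtain ⟨S, g, hg, hfg⟩ := f.2
  -- Coordinates of p are exchanged for those of q one at a time; exchanging the finitely many on
  -- which f depends reaches f q.
  have key : ∀ A : Finset JetIndex, f (A.piecewise q p) = f p := by
    intro A
    induction A using Finset.induction_on with
    | empty => simp
    | insert i A hi ih =>
      rw [Finset.piecewise_insert, ← ih]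
      set r := A.piecewise q p
      by_cases hI : i ∈ I
      · rw [← hpq i hI]
        have : p i = r i := (Finset.piecewise_eq_of_notMem A q p hi).symm
        rw [this, Function.update_eq_self]
      · have h : ∀ s, HasDerivAt (fun s => f (Function.update r i s)) 0 s := by
          intro s
          have h := hasDerivAt_update_partialD i f (Function.update r i s)
          rw [hf i hI] at h
          simpa using h
        have h' := is_const_of_deriv_eq_zero (fun s => (h s).differentiableAt)
          (fun s => (h s).deriv) (q i) (r i)
        rw [h', Function.update_eq_self]
  rw [← key S]
  change f.1 _ = f.1 _
  rw [hfg, hfg]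
  congr 1
  funext i
  exact Finset.piecewise_eq_of_mem S q p i.2

/-! ### Integrals along rays -/

section Param

variable {E F : Type} [NormedAddCommGroup E] [NormedSpace ℝ E] [ProperSpace E]
  [NormedAddCommGroup F] [NormedSpace ℝ F]

theorem hasFDerivAt_integral_of_contDiff {G : E → ℝ → F}
    (hG : ContDiff ℝ ∞ (Function.uncurry G)) (x : E) :
    HasFDerivAt (fun x => ∫ l in (0 : ℝ)..1, G x l)
      (∫ l in (0 : ℝ)..1, (fderiv ℝ (Function.uncurry G) (x, l)).comp
        (ContinuousLinearMap.inl ℝ E ℝ)) x := by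
  have hc : Continuous (Function.uncurry G) := hG.continuous
  have hG' : Continuous fun q : E × ℝ => (fderiv ℝ (Function.uncurry G) q).comp
      (ContinuousLinearMap.inl ℝ E ℝ) :=
    (hG.continuous_fderiv (by simp)).clm_comp continuous_const
  -- Compactness of the closed ball times [0, 1] supplies the constant that dominates the
  -- derivative.
  obtain ⟨C, hC⟩ := ((isCompact_closedBall x 1).prod
    (isCompact_Icc (a := (0 : ℝ)) (b := 1))).exists_bound_of_continuousOn hG'.continuousOn
  refine intervalIntegral.hasFDerivAt_integral_of_dominated_of_fderiv_le
    (bound := fun _ => C) (s := Metric.closedBall x 1)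
    (F' := fun x l => (fderiv ℝ (Function.uncurry G) (x, l)).comp
        (ContinuousLinearMap.inl ℝ E ℝ))
    (Metric.closedBall_mem_nhds x one_pos) (Filter.Eventually.of_forall fun y => ?_) ?_ ?_ ?_
    intervalIntegrable_const ?_
  · exact (hc.comp (Continuous.prodMk_right y)).aestronglyMeasurable
  · exact (hc.comp (Continuous.prodMk_right x)).intervalIntegrable _ _
  · exact (hG'.comp (Continuous.prodMk_right x)).aestronglyMeasurable
  · refine Filter.Eventually.of_forall fun l hl y hy => hC (y, l) ⟨hy, ?_⟩
    rw [Set.uIoc_of_le zero_le_one] at hl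
    exact ⟨hl.1.le, hl.2⟩
  · refine Filter.Eventually.of_forall fun l _ y _ => ?_
    have h1 : HasFDerivAt (Function.uncurry G) (fderiv ℝ (Function.uncurry G) (y, l)) (y, l) :=
      (hG.differentiable (by simp)).differentiableAt.hasFDerivAt
    exact HasFDerivAt.comp (f := fun y => (y, l)) y h1 (hasFDerivAt_prodMk_left y l)

/-- The derivative of the integral is again such an integral, with values in linear maps; hence the
induction on the order of smoothness lets the target space vary. -/
theorem contDiff_integral {G : E → ℝ → F} (hG : ContDiff ℝ ∞ (Function.uncurry G)) :
    ContDiff ℝ ∞ fun x => ∫ l in (0 : ℝ)..1, G x l := by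
  refine contDiff_infty.2 fun n => ?_
  induction n generalizing F with
  | zero =>
    exact contDiff_zero.2
      (intervalIntegral.continuous_parametric_intervalIntegral_of_continuous hG.continuous
        continuous_const)
  | succ n ih =>
    push_cast
    refine contDiff_succ_iff_hasFDerivAt.2 ⟨_, ?_, hasFDerivAt_integral_of_contDiff hG⟩
    exact ih ((hG.fderiv_right (m := ∞) (by simp)).clm_comp contDiff_const)

end Param

theorem hasDerivAt_integral_of_contDiff {G G' : ℝ → ℝ → ℝ}
    (hG : ContDiff ℝ ∞ (Function.uncurry G)) {x : ℝ}
    (h : ∀ l, HasDerivAt (fun y => G y l) (G' x l) x) :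
    HasDerivAt (fun x => ∫ l in (0 : ℝ)..1, G x l) (∫ l in (0 : ℝ)..1, G' x l) x := by
  have h1 := (hasFDerivAt_integral_of_contDiff hG x).hasDerivAt
  refine h1.congr_deriv ?_
  have hG' : Continuous fun q : ℝ × ℝ => (fderiv ℝ (Function.uncurry G) q).comp
      (ContinuousLinearMap.inl ℝ ℝ ℝ) :=
    (hG.continuous_fderiv (by simp)).clm_comp continuous_const
  have hi : IntervalIntegrable (fun l => (fderiv ℝ (Function.uncurry G) (x, l)).comp
      (ContinuousLinearMap.inl ℝ ℝ ℝ)) MeasureTheory.volume 0 1 :=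
    (hG'.comp (Continuous.prodMk_right x)).intervalIntegrable _ _
  rw [ContinuousLinearMap.intervalIntegral_apply hi]
  refine intervalIntegral.integral_congr fun l _ => ?_
  have h2 : HasFDerivAt (Function.uncurry G) (fderiv ℝ (Function.uncurry G) (x, l)) (x, l) :=
    (hG.differentiable (by simp)).differentiableAt.hasFDerivAt
  exact (HasFDerivAt.comp (f := fun y => (y, l)) x h2
    (hasFDerivAt_prodMk_left x l)).hasDerivAt.unique (h l)

/-- Multiplication of the coordinates in `W` by a number. -/
def scalePoint (W : JetIndex → Bool) (l : ℝ) (p : Jet) : Jet :=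
  fun i => if W i then l * p i else p i

theorem contDiff_scale (W : JetIndex → Bool) (f : DiffFun) {E : Type} [NormedAddCommGroup E]
    [NormedSpace ℝ E] {c : E → Jet} {r : E → ℝ} (hc : ∀ i, ContDiff ℝ ∞ fun x => c x i)
    (hr : ContDiff ℝ ∞ r) : ContDiff ℝ ∞ fun x => f (scalePoint W (r x) (c x)) := by
  refine f.contDiff_comp fun i => ?_
  unfold scalePoint
  by_cases h : W i
  · simpa [h] using hr.mul (hc i)
  · simpa [h] using hc i

theorem contDiff_scale_left (W : JetIndex → Bool) (f : DiffFun) (p : Jet) :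
    ContDiff ℝ ∞ fun l => f (scalePoint W l p) :=
  contDiff_scale W f (fun _ => contDiff_const) contDiff_id

theorem continuous_pow_mul_scale (W : JetIndex → Bool) (n : ℕ) (f : DiffFun) (p : Jet) :
    Continuous fun l => l ^ n * f (scalePoint W l p) :=
  (continuous_pow n).mul (contDiff_scale_left W f p).continuous

theorem isDiffFun_scaleIntegral (W : JetIndex → Bool) (n : ℕ) (f : DiffFun) :
    IsDiffFun fun p => ∫ l in (0 : ℝ)..1, l ^ n * f (scalePoint W l p) := by
  obtain ⟨S, g, hg, hf⟩ := f.2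
  refine ⟨S, fun v => ∫ l in (0 : ℝ)..1, l ^ n * g fun i => if W i then l * v i else v i,
    contDiff_integral ?_, fun p => ?_⟩
  · refine (contDiff_snd.pow n).mul (hg.comp (contDiff_pi.2 fun i => ?_))
    have h : ContDiff ℝ ∞ fun x : (S → ℝ) × ℝ => x.1 i := (contDiff_apply ℝ ℝ i).comp contDiff_fst
    by_cases hi : W i
    · simpa [hi] using contDiff_snd.mul h
    · simpa [hi] using h
  · refine intervalIntegral.integral_congr fun l _ => ?_
    simp only [hf]
    rfl

/-- The integral of `l ^ n f` along the ray that multiplies the coordinates in `W` by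
`l ∈ [0, 1]`. -/
def scaleIntegral (W : JetIndex → Bool) (n : ℕ) : Module.End ℝ DiffFun where
  toFun f := ⟨fun p => ∫ l in (0 : ℝ)..1, l ^ n * f (scalePoint W l p),
    isDiffFun_scaleIntegral W n f⟩
  map_add' f g := by
    ext p
    change ∫ l in (0 : ℝ)..1, l ^ n * (f _ + g _) = (∫ l in (0 : ℝ)..1, l ^ n * f _)
      + ∫ l in (0 : ℝ)..1, l ^ n * g _
    rw [← intervalIntegral.integral_add ((continuous_pow_mul_scale W n f p).intervalIntegrable _ _)
      ((continuous_pow_mul_scale W n g p).intervalIntegrable _ _)]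
    simp only [mul_add]
  map_smul' c f := by
    ext p
    change ∫ l in (0 : ℝ)..1, l ^ n * (c * f _) = c * ∫ l in (0 : ℝ)..1, l ^ n * f _
    rw [← intervalIntegral.integral_const_mul]
    simp only [mul_left_comm]

theorem scaleIntegral_eval (W : JetIndex → Bool) (n : ℕ) (f : DiffFun) (p : Jet) :
    scaleIntegral W n f p = ∫ l in (0 : ℝ)..1, l ^ n * f (scalePoint W l p) := rfl

theorem scalePoint_update (W : JetIndex → Bool) (l : ℝ) (p : Jet) (i : JetIndex) (s : ℝ) :
    scalePoint W l (Function.update p i s)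
      = Function.update (scalePoint W l p) i (if W i then l * s else s) := by
  funext j
  by_cases h : j = i
  · subst h; simp [scalePoint]
  · simp [scalePoint, h]

/-- The chain rule produces one more factor l exactly when the coordinate is among the scaled ones.
-/
theorem partialD_scaleIntegral (W : JetIndex → Bool) (n : ℕ) (i : JetIndex) (f : DiffFun) :
    partialD i (scaleIntegral W n f)
      = scaleIntegral W (n + if W i then 1 else 0) (partialD i f) := by
  ext p
  rw [partialD_eval]
  refine (hasDerivAt_integral_of_contDiff
    (G := fun s l => l ^ n * f (scalePoint W l (Function.update p i s)))
    (G' := fun s l => l ^ (n + if W i then 1 else 0)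
      * partialD i f (scalePoint W l (Function.update p i s))) ?_ fun l => ?_).deriv.trans ?_
  · refine (contDiff_snd.pow n).mul (contDiff_scale W f (fun j => ?_) contDiff_snd)
    by_cases h : j = i
    · subst h; simpa using contDiff_fst
    · simpa [h] using contDiff_const
  · have h1 := hasDerivAt_update_partialD i f (scalePoint W l p)
    have h2 : HasDerivAt (fun s : ℝ => if W i then l * s else s) (if W i then l else 1) (p i) := by
      split_ifs
      · simpa using (hasDerivAt_id (p i)).const_mul l
      · exact hasDerivAt_id (p i)
    have h4 := (HasDerivAt.comp (h₂ := fun s => f (Function.update (scalePoint W l p) i s))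
      (h := fun s : ℝ => if W i then l * s else s) (p i) h1 h2).const_mul (l ^ n)
    simp only [Function.update_eq_self]
    have e : (fun s => l ^ n * f (scalePoint W l (Function.update p i s))) = fun s => l ^ n *
        ((fun s => f (Function.update (scalePoint W l p) i s)) ∘
          fun s => if W i then l * s else s) s := by
      funext s
      rw [scalePoint_update]
      rfl
    rw [e]
    refine h4.congr_deriv ?_
    split_ifs <;> ring
  · simp [scaleIntegral_eval]

theorem scaleIntegral_mul (W : JetIndex → Bool) (n k : ℕ) {x : DiffFun}
    (hx : ∀ l p, x (scalePoint W l p) = l ^ k * x p) (f : DiffFun) :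
    scaleIntegral W n (x * f) = x * scaleIntegral W (n + k) f := by
  ext p
  rw [mul_eval, scaleIntegral_eval, scaleIntegral_eval, ← intervalIntegral.integral_const_mul]
  refine intervalIntegral.integral_congr fun l _ => ?_
  simp only [mul_eval, hx]
  ring

theorem hasDerivAt_scale (W : JetIndex → Bool) (f : DiffFun) (p : Jet) (l : ℝ) :
    HasDerivAt (fun l => f (scalePoint W l p))
      (∑ μ, (if W (Sum.inl μ) then p (Sum.inl μ) else 0)
          * partialD (Sum.inl μ) f (scalePoint W l p)
        + (vgrad f).sum fun α a => (if W (Sum.inr α) then p (Sum.inr α) else 0)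
          * a (scalePoint W l p)) l := by
  refine f.hasDerivAt_comp (v := fun i => if W i then p i else 0) fun i => ?_
  unfold scalePoint
  split_ifs
  · simpa using (hasDerivAt_id l).mul_const (p i)
  · exact hasDerivAt_const _ _

/-- The jet variables. -/
def isJetVar : JetIndex → Bool := Sum.elim (fun _ => false) (fun _ => true)

/-- Fundamental theorem of calculus along the ray from 0 to u: the l-derivative of f at lu is the
linearization of f at lu applied to u. This is the homotopy formula behind the exactness result. -/
theorem eval_sub_eval_scalePoint_zero (f : DiffFun) (p : Jet) :
    f p - f (scalePoint isJetVar 0 p) = Finsupp.linearCombination DiffFun jetVar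
      (Finsupp.mapRange.linearMap (scaleIntegral isJetVar 0) (vgrad f)) p := by
  have hc : ∀ α ∈ (vgrad f).support, Continuous fun l =>
      p (Sum.inr α) * vgrad f α (scalePoint isJetVar l p) := fun α _ =>
    continuous_const.mul (contDiff_scale_left _ _ _).continuous
  have h : ∀ l, HasDerivAt (fun l => f (scalePoint isJetVar l p))
      (∑ α ∈ (vgrad f).support, p (Sum.inr α) * vgrad f α (scalePoint isJetVar l p)) l := fun l =>
    (hasDerivAt_scale isJetVar f p l).congr_deriv (by simp [isJetVar, Finsupp.sum])
  have h1 : (∫ l in (0 : ℝ)..1, ∑ α ∈ (vgrad f).support, p (Sum.inr α)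
      * vgrad f α (scalePoint isJetVar l p))
        = f (scalePoint isJetVar 1 p) - f (scalePoint isJetVar 0 p) :=
    intervalIntegral.integral_eq_sub_of_hasDerivAt (fun l _ => h l)
      ((continuous_finsetSum _ hc).intervalIntegrable _ _)
  have h2 : scalePoint isJetVar 1 p = p := by
    funext i; simp [scalePoint]
  rw [h2] at h1
  rw [← h1, intervalIntegral.integral_finsetSum fun α hα => (hc α hα).intervalIntegrable _ _,
    Finsupp.linearCombination_apply, Finsupp.mapRange.linearMap_apply,
    Finsupp.sum_mapRange_index (by simp), Finsupp.sum, sum_eval]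
  refine Finset.sum_congr rfl fun α _ => ?_
  rw [intervalIntegral.integral_const_mul, smul_eq_mul, mul_eval, mul_comm, scaleIntegral_eval]
  simp

/-- Integrate the l-derivative of l f, with f taken at the scaled point, over [0, 1]. For W = {x}
this says that f is the x-derivative of x ∫ f(t, lx, y) dl. -/
theorem eq_scaleIntegral {W : JetIndex → Bool} (hW : ∀ α, W (Sum.inr α) = false) (f : DiffFun) :
    f = scaleIntegral W 0 f + ∑ μ, if W (Sum.inl μ) then
      baseVar μ * scaleIntegral W 1 (partialD (Sum.inl μ) f) else 0 := by
  ext p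
  have hc : ∀ g : DiffFun, Continuous fun l => g (scalePoint W l p) := fun g =>
    (contDiff_scale_left _ _ _).continuous
  have hc' : ∀ μ ∈ Finset.univ, Continuous fun l => l *
      ((if W (Sum.inl μ) then p (Sum.inl μ) else 0)
        * partialD (Sum.inl μ) f (scalePoint W l p)) := fun μ _ =>
    continuous_id.mul (continuous_const.mul (hc _))
  have h1 : (∫ l in (0 : ℝ)..1, (f (scalePoint W l p) + ∑ μ, l * ((if W (Sum.inl μ) then
      p (Sum.inl μ) else 0) * partialD (Sum.inl μ) f (scalePoint W l p))))
        = 1 * f (scalePoint W 1 p) - 0 * f (scalePoint W 0 p) :=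
    intervalIntegral.integral_eq_sub_of_hasDerivAt (f := fun l => l * f (scalePoint W l p))
      (fun l _ => ((hasDerivAt_id' l).mul (hasDerivAt_scale W f p l)).congr_deriv
        (by simp [hW, Finset.mul_sum]))
      (((hc f).add (continuous_finsetSum _ hc')).intervalIntegrable _ _)
  have h2 : scalePoint W 1 p = p := by
    funext i; simp [scalePoint]
  rw [h2, one_mul, zero_mul, sub_zero, intervalIntegral.integral_add
    ((hc f).intervalIntegrable _ _) ((continuous_finsetSum _ hc').intervalIntegrable _ _),
    intervalIntegral.integral_finsetSum fun μ hμ => (hc' μ hμ).intervalIntegrable _ _] at h1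
  rw [← h1, add_eval, sum_eval, scaleIntegral_eval]
  congr 1
  · simp
  · refine Finset.sum_congr rfl fun μ _ => ?_
    split_ifs
    · rw [mul_eval, scaleIntegral_eval, baseVar_eval, ← intervalIntegral.integral_const_mul]
      refine intervalIntegral.integral_congr fun l _ => ?_
      simp only [pow_one]
      ring
    · simp

/-! ### Total derivatives and symbols of linearizations -/

theorem totalD_eq (μ : Fin 3) (f : DiffFun) :
    totalD μ f = partialD (Sum.inl μ) f
      + Finsupp.linearCombination DiffFun (fun α => jetVar (α + Pi.single μ 1)) (vgrad f) := by
  ext p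
  change totalDerivFun μ f.1 p = _
  rw [IsDiffFun.totalDerivFun_eq_sum μ (S := (vgrad f).support), add_eval,
    Finsupp.linearCombination_apply, Finsupp.sum, sum_eval]
  · congr 1
    refine Finset.sum_congr rfl fun α _ => ?_
    rw [smul_eq_mul, mul_eval, mul_comm]
    rfl
  · rintro α ⟨q, hq⟩
    refine Finsupp.mem_support_iff.2 fun h => hq ?_
    exact congrArg (fun g : DiffFun => g q) h

theorem totalD_mul (μ : Fin 3) (f g : DiffFun) :
    totalD μ (f * g) = totalD μ f * g + f * totalD μ g := by
  simp only [totalD_eq, partialD_mul, vgrad_mul, map_add, map_smul, smul_eq_mul]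
  ring

theorem totalD_jetVar (μ : Fin 3) (α : MultiIndex) :
    totalD μ (jetVar α) = jetVar (α + Pi.single μ 1) := by
  simp [totalD_eq, partialD_inl_jetVar, vgrad_jetVar]

theorem partialD_linearCombination (i : JetIndex) (a : MultiIndex → DiffFun)
    (x : MultiIndex →₀ DiffFun) :
    partialD i (Finsupp.linearCombination DiffFun a x)
      = Finsupp.linearCombination DiffFun (fun α => partialD i (a α)) x
        + Finsupp.linearCombination DiffFun a (Finsupp.mapRange.linearMap (partialD i) x) := by
  induction x using Finsupp.induction_linear with
  | zero => simp
  | add x y hx hy => simp only [map_add, hx, hy]; abel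
  | single α g => simp [partialD_mul]; ring

/-- The operator on symbols `∑ g_α ∂^α` that corresponds to the composition with a total derivative
from the left. -/
def symbolD (μ : Fin 3) : Module.End ℝ (MultiIndex →₀ DiffFun) :=
  Finsupp.mapRange.linearMap (totalD μ) + Finsupp.lmapDomain DiffFun ℝ (· + Pi.single μ 1)

theorem symbolD_single (μ : Fin 3) (α : MultiIndex) (g : DiffFun) :
    symbolD μ (Finsupp.single α g)
      = Finsupp.single α (totalD μ g) + Finsupp.single (α + Pi.single μ 1) g := by
  simp [symbolD]

theorem symbolD_apply_add (μ : Fin 3) (x : MultiIndex →₀ DiffFun) (β : MultiIndex) :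
    symbolD μ x (β + Pi.single μ 1) = totalD μ (x (β + Pi.single μ 1)) + x β := by
  simp only [symbolD, LinearMap.add_apply, Finsupp.add_apply, Finsupp.mapRange.linearMap_apply,
    Finsupp.mapRange_apply, Finsupp.lmapDomain_apply]
  rw [Finsupp.mapDomain_apply (add_left_injective (Pi.single μ 1 : MultiIndex))]

theorem symbolD_apply_of_eq_zero {μ : Fin 3} (x : MultiIndex →₀ DiffFun) {β : MultiIndex}
    (hβ : β μ = 0) : symbolD μ x β = totalD μ (x β) := by
  simp only [symbolD, LinearMap.add_apply, Finsupp.add_apply, Finsupp.mapRange.linearMap_apply,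
    Finsupp.mapRange_apply, Finsupp.lmapDomain_apply]
  rw [Finsupp.mapDomain_of_notMem_range, add_zero]
  rintro ⟨α, rfl⟩
  simp at hβ

theorem mapRange_partialD_vgrad (i : JetIndex) (f : DiffFun) :
    Finsupp.mapRange.linearMap (partialD i) (vgrad f) = vgrad (partialD i f) := by
  ext1 α
  simp [partialD_comm i]

/-- The linearization of D_μ f is D_μ composed with the linearization of f. In coefficients, this is
the commutation relation between ∂_{u_β} and D_μ, whose extra term is ∂/∂u_{β-ε_μ}. -/
theorem vgrad_totalD (μ : Fin 3) (f : DiffFun) : vgrad (totalD μ f) = symbolD μ (vgrad f) := by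
  ext1 β
  have h : ∀ x : MultiIndex →₀ DiffFun, Finsupp.linearCombination DiffFun
      (fun α => partialD (Sum.inr β) (jetVar (α + Pi.single μ 1))) x
        = Finsupp.mapDomain (· + Pi.single μ 1) x β := by
    intro x
    induction x using Finsupp.induction_linear with
    | zero => simp
    | add x y hx hy => simp only [map_add, hx, hy, Finsupp.mapDomain_add, Finsupp.add_apply]
    | single α g =>
      rw [Finsupp.linearCombination_single, Finsupp.mapDomain_single, Finsupp.single_apply,
        partialD_jetVar]
      simp
  simp only [symbolD, LinearMap.add_apply, Finsupp.add_apply, Finsupp.mapRange.linearMap_apply,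
    Finsupp.mapRange_apply, Finsupp.lmapDomain_apply]
  rw [vgrad_apply, totalD_eq, map_add, partialD_linearCombination, h, mapRange_partialD_vgrad,
    partialD_comm, vgrad_apply, totalD_eq]
  abel

theorem partialD_totalD_add (μ : Fin 3) (β : MultiIndex) (f : DiffFun) :
    partialD (Sum.inr (β + Pi.single μ 1)) (totalD μ f)
      = totalD μ (partialD (Sum.inr (β + Pi.single μ 1)) f) + partialD (Sum.inr β) f := by
  rw [← vgrad_apply, vgrad_totalD, symbolD_apply_add]
  rfl

theorem partialD_totalD_of_eq_zero {μ : Fin 3} {β : MultiIndex} (hβ : β μ = 0) (f : DiffFun) :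
    partialD (Sum.inr β) (totalD μ f) = totalD μ (partialD (Sum.inr β) f) := by
  rw [← vgrad_apply, vgrad_totalD, symbolD_apply_of_eq_zero _ hβ]
  rfl

theorem partialD_inl_totalD (μ ν : Fin 3) (f : DiffFun) :
    partialD (Sum.inl ν) (totalD μ f) = totalD μ (partialD (Sum.inl ν) f) := by
  have h0 : (fun α : MultiIndex => partialD (Sum.inl ν) (jetVar (α + Pi.single μ 1))) = 0 := by
    funext α
    exact partialD_inl_jetVar _ _
  rw [totalD_eq, map_add, partialD_linearCombination, mapRange_partialD_vgrad, totalD_eq,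
    partialD_comm, h0]
  simp

/-- If a_α = D^α a, the linear combination is the operator with symbol x applied to a, and the
identity is Leibniz' rule. -/
theorem linearCombination_symbolD {μ : Fin 3} {a : MultiIndex → DiffFun}
    (ha : ∀ α : MultiIndex, a (α + Pi.single μ 1) = totalD μ (a α)) (x : MultiIndex →₀ DiffFun) :
    Finsupp.linearCombination DiffFun a (symbolD μ x)
      = totalD μ (Finsupp.linearCombination DiffFun a x) := by
  induction x using Finsupp.induction_linear with
  | zero => simp
  | add x y hx hy => simp only [map_add, hx, hy]
  | single α g => simp [symbolD_single, totalD_mul, ha]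

/-- The vector field `∂_ν + ∑ a_α ∂_{u_α}` on the jet space. -/
def transport (ν : Fin 3) (a : MultiIndex → DiffFun) : Module.End ℝ DiffFun :=
  partialD (Sum.inl ν) + (Finsupp.linearCombination DiffFun a).restrictScalars ℝ ∘ₗ vgrad

theorem transport_apply (ν : Fin 3) (a : MultiIndex → DiffFun) (f : DiffFun) :
    transport ν a f
      = partialD (Sum.inl ν) f + Finsupp.linearCombination DiffFun a (vgrad f) := rfl

theorem totalD_eq_transport (μ : Fin 3) :
    totalD μ = transport μ fun α => jetVar (α + Pi.single μ 1) :=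
  LinearMap.ext fun f => totalD_eq μ f

/-- The prolongation condition on the coefficients is what makes the field commute with D_μ. Both
the commutativity of the total derivatives and that of `evolutionD` with them are instances. -/
theorem transport_totalD {μ : Fin 3} {a : MultiIndex → DiffFun}
    (ha : ∀ α : MultiIndex, a (α + Pi.single μ 1) = totalD μ (a α)) (ν : Fin 3) (f : DiffFun) :
    transport ν a (totalD μ f) = totalD μ (transport ν a f) := by
  rw [transport_apply, transport_apply, vgrad_totalD, linearCombination_symbolD ha,
    partialD_inl_totalD, map_add]

theorem transport_jetVar (ν : Fin 3) (a : MultiIndex → DiffFun) (α : MultiIndex) :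
    transport ν a (jetVar α) = a α := by
  simp [transport_apply, partialD_inl_jetVar, vgrad_jetVar]

theorem totalD_comm (μ ν : Fin 3) : Commute (totalD μ) (totalD ν) := by
  refine LinearMap.ext fun f => ?_
  simp only [Module.End.mul_apply]
  rw [totalD_eq_transport μ, transport_totalD]
  intro α
  rw [totalD_jetVar, add_right_comm]

/-- The product `A_0^{α_0} A_1^{α_1} A_2^{α_2}`. -/
def iter (A : Fin 3 → Module.End ℝ DiffFun) (α : MultiIndex) : Module.End ℝ DiffFun :=
  A 0 ^ α 0 * A 1 ^ α 1 * A 2 ^ α 2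

theorem iter_zero (A : Fin 3 → Module.End ℝ DiffFun) : iter A 0 = 1 := by
  simp [iter]

theorem iter_add_single {A : Fin 3 → Module.End ℝ DiffFun} (hA : ∀ μ ν, Commute (A μ) (A ν))
    (α : MultiIndex) (μ : Fin 3) : iter A (α + Pi.single μ 1) = A μ * iter A α := by
  fin_cases μ
  · simp [iter, pow_succ', mul_assoc]
  · have h : A 0 ^ α 0 * A 1 = A 1 * A 0 ^ α 0 := ((hA 0 1).pow_left _).eq
    simp only [iter, Fin.mk_one, Pi.add_apply, Pi.single_apply]
    simp only [Fin.reduceEq, if_false, add_zero, if_true, ← mul_assoc, h, pow_succ', Fin.isValue]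
  · have h : A 0 ^ α 0 * A 1 ^ α 1 * A 2 = A 2 * (A 0 ^ α 0 * A 1 ^ α 1) :=
      (((hA 0 2).pow_left _).mul_left ((hA 1 2).pow_left _)).eq
    simp only [iter, Fin.reduceFinMk, Pi.add_apply, Pi.single_apply]
    simp [pow_succ', ← mul_assoc, h]

theorem totalDIter_eq_iter : totalDIter = iter totalD := rfl

theorem totalDIter_add_single (α : MultiIndex) (μ : Fin 3) (f : DiffFun) :
    totalDIter (α + Pi.single μ 1) f = totalD μ (totalDIter α f) := by
  rw [totalDIter_eq_iter, iter_add_single totalD_comm]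
  rfl

theorem totalDIter_zero (f : DiffFun) : totalDIter 0 f = f := by
  rw [totalDIter_eq_iter, iter_zero]
  rfl

/-- Induction on multi-indices. -/
theorem multiIndex_induction {P : MultiIndex → Prop} (h0 : P 0)
    (h : ∀ α μ, P α → P (α + Pi.single μ 1)) (α : MultiIndex) : P α := by
  obtain ⟨n, hn⟩ : ∃ n, n = ∑ μ, α μ := ⟨_, rfl⟩
  induction n generalizing α with
  | zero =>
    have : α = 0 := by
      funext μ
      exact (Finset.sum_eq_zero_iff.1 hn.symm) μ (Finset.mem_univ μ)
    exact this ▸ h0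
  | succ n ih =>
    obtain ⟨μ, -, hμ⟩ : ∃ μ ∈ Finset.univ, α μ ≠ 0 :=
      Finset.exists_ne_zero_of_sum_ne_zero (by omega)
    have e : α = (α - Pi.single μ 1) + Pi.single μ 1 := by
      funext ν
      by_cases hν : ν = μ
      · subst hν; simp; omega
      · simp [hν]
    rw [e]
    refine h _ μ (ih _ ?_)
    rw [e] at hn
    simp only [Pi.add_apply, Finset.sum_add_distrib, Finset.sum_pi_single', Finset.mem_univ,
      if_true] at hn
    omega

theorem totalDIter_jetVar (α β : MultiIndex) :
    totalDIter α (jetVar β) = jetVar (β + α) := by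
  induction α using multiIndex_induction with
  | h0 => rw [totalDIter_zero, add_zero]
  | h α μ ih => rw [totalDIter_add_single, ih, totalD_jetVar, add_assoc]

/-! ### Division of symbols by total derivatives -/

/-- Leading coefficients survive: if α has the largest α_μ in the support of x, then D_μ ∘ x has
coefficient x_α at α + ε_μ. -/
theorem symbolD_eq_zero {μ : Fin 3} {x : MultiIndex →₀ DiffFun} (hx : symbolD μ x = 0) :
    x = 0 := by
  by_contra h
  obtain ⟨α, hα, hmax⟩ := x.support.exists_max_image (fun α => α μ)
    (Finsupp.support_nonempty_iff.2 h)
  have h1 : x (α + Pi.single μ 1) = 0 := by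
    by_contra h2
    have := hmax _ (Finsupp.mem_support_iff.2 h2)
    simp at this
  have h2 := symbolD_apply_add μ x α
  rw [hx, h1, map_zero, zero_add] at h2
  exact Finsupp.mem_support_iff.1 hα h2.symm

/-- The map that replaces the symbol `∂^α` by its remainder modulo the total derivative with index
`μ`. -/
def symbolRem (μ : Fin 3) : Module.End ℝ (MultiIndex →₀ DiffFun) :=
  Finsupp.lsum ℝ fun α =>
    Finsupp.lsingle (Function.update α μ 0) ∘ₗ (-totalD μ) ^ α μ

theorem symbolRem_single (μ : Fin 3) (α : MultiIndex) (g : DiffFun) :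
    symbolRem μ (Finsupp.single α g)
      = Finsupp.single (Function.update α μ 0) (((-totalD μ) ^ α μ) g) := by
  simp [symbolRem]

/-- The two terms of D_μ ∘ g ∂^α have the same index once the exponent of ∂_μ is erased, and their
coefficients cancel because of the sign in (-D_μ)^n. -/
theorem symbolRem_symbolD_self (μ : Fin 3) (x : MultiIndex →₀ DiffFun) :
    symbolRem μ (symbolD μ x) = 0 := by
  induction x using Finsupp.induction_linear with
  | zero => simp
  | add x y hx hy => simp only [map_add, hx, hy, add_zero]
  | single α g =>
    have h : Function.update (α + Pi.single μ 1) μ 0 = Function.update α μ 0 := by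
      funext ν
      by_cases hν : ν = μ
      · subst hν; simp
      · simp [hν]
    rw [symbolD_single, map_add, symbolRem_single, symbolRem_single, h, ← Finsupp.single_add]
    simp [pow_succ]

theorem symbolRem_symbolD {μ ν : Fin 3} (hμν : μ ≠ ν) (x : MultiIndex →₀ DiffFun) :
    symbolRem μ (symbolD ν x) = symbolD ν (symbolRem μ x) := by
  induction x using Finsupp.induction_linear with
  | zero => simp
  | add x y hx hy => simp only [map_add, hx, hy]
  | single α g =>
    have h : Function.update (α + Pi.single ν 1) μ 0 = Function.update α μ 0 + Pi.single ν 1 := by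
      funext κ
      by_cases hκ : κ = μ
      · subst hκ; simp [hμν]
      · simp [hκ]
    have h' := LinearMap.congr_fun ((totalD_comm μ ν).neg_left.pow_left (α μ)).eq g
    simp only [Module.End.mul_apply] at h'
    rw [symbolD_single, map_add, symbolRem_single, symbolRem_single, symbolRem_single,
      symbolD_single, h, h']
    simp [hμν]

/-- Integration by parts: g ∂^{β+ε_μ} = D_μ ∘ g ∂^β - (D_μ g) ∂^β, repeated until the exponent of
∂_μ is zero. -/
theorem sub_symbolRem_mem (μ : Fin 3) (x : MultiIndex →₀ DiffFun) :
    x - symbolRem μ x ∈ LinearMap.range (symbolD μ) := by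
  induction x using Finsupp.induction_linear with
  | zero => simp
  | add x y hx hy =>
    rw [map_add, add_sub_add_comm]
    exact add_mem hx hy
  | single α g =>
    obtain ⟨n, hn⟩ : ∃ n, α μ = n := ⟨_, rfl⟩
    induction n generalizing α g with
    | zero =>
      rw [symbolRem_single, hn, ← hn, Function.update_eq_self, hn]
      simp
    | succ n ih =>
      obtain ⟨β, hβ, rfl⟩ : ∃ β : MultiIndex, β μ = n ∧ β + Pi.single μ 1 = α := by
        refine ⟨Function.update α μ n, by simp, ?_⟩
        funext ν
        by_cases hν : ν = μ
        · subst hν; simp [hn]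
        · simp [hν]
      have e : Finsupp.single (β + Pi.single μ 1) g
          = symbolD μ (Finsupp.single β g) - Finsupp.single β (totalD μ g) := by
        rw [symbolD_single, add_sub_cancel_left]
      have e' : Finsupp.single (β + Pi.single μ 1) g
          - symbolRem μ (Finsupp.single (β + Pi.single μ 1) g) = symbolD μ (Finsupp.single β g)
            - (Finsupp.single β (totalD μ g) - symbolRem μ (Finsupp.single β (totalD μ g))) := by
        rw [e, map_sub, symbolRem_symbolD_self]
        abel
      rw [e']
      exact sub_mem ⟨_, rfl⟩ (ih β _ hβ)

theorem exists_of_symbolRem_eq_zero {μ : Fin 3} {x : MultiIndex →₀ DiffFun}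
    (hx : symbolRem μ x = 0) : ∃ y, x = symbolD μ y := by
  obtain ⟨y, hy⟩ := sub_symbolRem_mem μ x
  exact ⟨y, by rw [hy, hx, sub_zero]⟩

theorem exists_add_of_symbolRem_eq_zero {μ ν : Fin 3} {x : MultiIndex →₀ DiffFun}
    (hx : symbolRem μ (symbolRem ν x) = 0) : ∃ y z, x = symbolD μ y + symbolD ν z := by
  obtain ⟨y, hy⟩ := exists_of_symbolRem_eq_zero hx
  obtain ⟨z, hz⟩ := sub_symbolRem_mem ν x
  exact ⟨y, z, by rw [hz, ← hy]; abel⟩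

/-! ### Homotopies -/

theorem vgrad_scaleIntegral_isJetVar (f : DiffFun) :
    vgrad (scaleIntegral isJetVar 0 f)
      = Finsupp.mapRange.linearMap (scaleIntegral isJetVar 1) (vgrad f) := by
  ext1 α
  simp [partialD_scaleIntegral, isJetVar]

/-- The factor l from differentiating f at lu equals the factor l by which u_{α+ε_μ} scales, so
dilation of u commutes with D_μ. -/
theorem totalD_scaleIntegral (μ : Fin 3) (f : DiffFun) :
    totalD μ (scaleIntegral isJetVar 0 f) = scaleIntegral isJetVar 0 (totalD μ f) := by
  have h : ∀ x : MultiIndex →₀ DiffFun, Finsupp.linearCombination DiffFun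
      (fun α => jetVar (α + Pi.single μ 1))
        (Finsupp.mapRange.linearMap (scaleIntegral isJetVar 1) x)
      = scaleIntegral isJetVar 0 (Finsupp.linearCombination DiffFun
          (fun α => jetVar (α + Pi.single μ 1)) x) := by
    intro x
    induction x using Finsupp.induction_linear with
    | zero => simp
    | add x y hx hy => simp only [map_add, hx, hy]
    | single α g =>
      have h1 := scaleIntegral_mul isJetVar 0 1 (x := jetVar (α + Pi.single μ 1))
        (fun l p => by simp [scalePoint, isJetVar]) g
      simp [mul_comm _ (jetVar _), h1]
  rw [totalD_eq, totalD_eq, map_add, vgrad_scaleIntegral_isJetVar, h, partialD_scaleIntegral]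
  simp [isJetVar]

/-- The value at `u` of the operator with symbol `x` averaged along the ray from `0` to `u`. -/
def homotopy (x : MultiIndex →₀ DiffFun) : DiffFun :=
  Finsupp.linearCombination DiffFun jetVar
    (Finsupp.mapRange.linearMap (scaleIntegral isJetVar 0) x)

theorem homotopy_add (x y : MultiIndex →₀ DiffFun) :
    homotopy (x + y) = homotopy x + homotopy y := by
  simp only [homotopy, map_add]

/-- Together with the homotopy formula, this converts divisibility of the linearization of f by
total derivatives into a divergence representation of f itself. -/
theorem homotopy_symbolD (μ : Fin 3) (x : MultiIndex →₀ DiffFun) :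
    homotopy (symbolD μ x) = totalD μ (homotopy x) := by
  have h : Finsupp.mapRange.linearMap (scaleIntegral isJetVar 0) (symbolD μ x)
      = symbolD μ (Finsupp.mapRange.linearMap (scaleIntegral isJetVar 0) x) := by
    induction x using Finsupp.induction_linear with
    | zero => simp
    | add x y hx hy => simp only [map_add, hx, hy]
    | single α g =>
      rw [symbolD_single, map_add]
      simp [symbolD_single, totalD_scaleIntegral]
  rw [homotopy, h, linearCombination_symbolD fun α => (totalD_jetVar μ α).symm]
  rfl

/-- By the homotopy formula the difference is f at u = 0, a function of t, x, y only. -/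
theorem vgrad_sub_homotopy (f : DiffFun) : vgrad (f - homotopy (vgrad f)) = 0 := by
  ext1 α
  ext p
  have h : ∀ q, (f - homotopy (vgrad f)) q = f (scalePoint isJetVar 0 q) := fun q => by
    rw [sub_eval, homotopy, ← eval_sub_eval_scalePoint_zero, sub_sub_cancel]
  rw [vgrad_apply, partialD_eval]
  simp only [h, scalePoint_update]
  simp [isJetVar]

theorem totalD_of_vgrad_eq_zero (μ : Fin 3) {f : DiffFun} (hf : vgrad f = 0) :
    totalD μ f = partialD (Sum.inl μ) f := by
  rw [totalD_eq, hf, map_zero, add_zero]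

theorem partialD_inr_of_vgrad_eq_zero (α : MultiIndex) {f : DiffFun} (hf : vgrad f = 0) :
    partialD (Sum.inr α) f = 0 := by
  rw [← vgrad_apply, hf]
  rfl

theorem vgrad_baseVar (μ : Fin 3) : vgrad (baseVar μ) = 0 :=
  Finsupp.ext fun α => partialD_inr_baseVar α μ

theorem vgrad_partialD_inl (μ : Fin 3) {f : DiffFun} (hf : vgrad f = 0) :
    vgrad (partialD (Sum.inl μ) f) = 0 := by
  ext1 α
  rw [vgrad_apply, partialD_comm, partialD_inr_of_vgrad_eq_zero α hf, map_zero]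
  rfl

theorem vgrad_scaleIntegral (W : JetIndex → Bool) (n : ℕ) {f : DiffFun} (hf : vgrad f = 0) :
    vgrad (scaleIntegral W n f) = 0 := by
  ext1 α
  rw [vgrad_apply, partialD_scaleIntegral, partialD_inr_of_vgrad_eq_zero α hf, map_zero]
  rfl

theorem vgrad_baseVar_mul_scaleIntegral (W : JetIndex → Bool) (n : ℕ) (μ : Fin 3) {f : DiffFun}
    (hf : vgrad f = 0) : vgrad (baseVar μ * scaleIntegral W n f) = 0 := by
  rw [vgrad_mul, vgrad_scaleIntegral W n hf, vgrad_baseVar, smul_zero, smul_zero, add_zero]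

/-- The indicator of a set of independent variables. -/
def baseIndicator (I : Finset (Fin 3)) : JetIndex → Bool :=
  Sum.elim (fun μ => decide (μ ∈ I)) (fun _ => false)

theorem exists_eq_totalD_of_vgrad_eq_zero {f : DiffFun} (hf : vgrad f = 0) :
    ∃ A, f = totalD 1 A := by
  have h := eq_scaleIntegral (W := baseIndicator {1}) (fun _ => rfl) f
  -- The antiderivative in x that vanishes at x = 0.
  refine ⟨baseVar 1 * scaleIntegral (baseIndicator {1}) 0 f, ?_⟩
  rw [totalD_of_vgrad_eq_zero 1 (vgrad_baseVar_mul_scaleIntegral _ _ _ hf), partialD_mul,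
    partialD_scaleIntegral, partialD_baseVar]
  simpa [Fin.sum_univ_three, baseIndicator] using h

/-- Exactness: the kernel of the variational derivative in x and y consists of divergences in x and
y. The homotopy handles f minus its value at u = 0, and that value is integrated in x. -/
theorem exists_eq_totalD_add {f : DiffFun} (hf : symbolRem 1 (symbolRem 2 (vgrad f)) = 0) :
    ∃ A B, f = totalD 1 A + totalD 2 B := by
  obtain ⟨y, z, h⟩ := exists_add_of_symbolRem_eq_zero hf
  obtain ⟨A, hA⟩ := exists_eq_totalD_of_vgrad_eq_zero (vgrad_sub_homotopy f)
  refine ⟨A + homotopy y, homotopy z, ?_⟩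
  rw [map_add, ← hA, h, homotopy_add, homotopy_symbolD, homotopy_symbolD]
  abel

/-! ### Restriction to the solutions -/

theorem multiIndex_cases (α : MultiIndex) (μ : Fin 3) :
    α μ = 0 ∨ ∃ β : MultiIndex, α = β + Pi.single μ 1 := by
  refine or_iff_not_imp_left.2 fun h => ⟨Function.update α μ (α μ - 1), ?_⟩
  funext ν
  by_cases hν : ν = μ
  · subst hν; simp; omega
  · simp [hν]

theorem cons100 : (![1, 0, 0] : MultiIndex) = Pi.single 0 1 := by decide
theorem cons010 : (![0, 1, 0] : MultiIndex) = Pi.single 1 1 := by decide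
theorem cons001 : (![0, 0, 1] : MultiIndex) = Pi.single 2 1 := by decide
theorem cons002 : (![0, 0, 2] : MultiIndex) = Pi.single 2 1 + Pi.single 2 1 := by decide
theorem cons000 : (![0, 0, 0] : MultiIndex) = 0 := by decide

/-- The right-hand side of the equation solved for `u_t`. -/
def evolutionRHS : DiffFun := jetVar ![0, 0, 2] - jetVar ![0, 0, 0] * jetVar ![0, 1, 0]

theorem burgers_eq : burgers = jetVar ![1, 0, 0] - evolutionRHS := by
  rw [burgers, evolutionRHS]
  ring

/-- The total derivative with respect to `t` in view of the equation. -/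
def evolutionD : Module.End ℝ DiffFun := transport 0 fun α => totalDIter α evolutionRHS

theorem evolutionD_totalD (μ : Fin 3) : Commute evolutionD (totalD μ) :=
  LinearMap.ext fun f => transport_totalD (fun α => totalDIter_add_single α μ _) 0 f

/-- The total derivatives in view of the equation. -/
def reducedD : Fin 3 → Module.End ℝ DiffFun := ![evolutionD, totalD 1, totalD 2]

theorem reducedD_of_ne_zero {μ : Fin 3} (hμ : μ ≠ 0) : reducedD μ = totalD μ := by
  fin_cases μ
  · exact absurd rfl hμ
  · rfl
  · rfl

theorem reducedD_comm (μ ν : Fin 3) : Commute (reducedD μ) (reducedD ν) := by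
  by_cases hμ : μ = 0 <;> by_cases hν : ν = 0
  · subst hμ hν; exact Commute.refl _
  · subst hμ; rw [reducedD_of_ne_zero hν]; exact evolutionD_totalD ν
  · subst hν; rw [reducedD_of_ne_zero hμ]; exact (evolutionD_totalD μ).symm
  · rw [reducedD_of_ne_zero hμ, reducedD_of_ne_zero hν]; exact totalD_comm μ ν

/-- The expression of `u_α` in terms of the derivatives of `u` with respect to `x` and `y` in view
of the equation. -/
def reducedVar (α : MultiIndex) : DiffFun := iter reducedD α (jetVar 0)

theorem reducedVar_add_single (α : MultiIndex) (μ : Fin 3) :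
    reducedVar (α + Pi.single μ 1) = reducedD μ (reducedVar α) := by
  rw [reducedVar, iter_add_single reducedD_comm]
  rfl

/-- The projection of the jet space to the solutions. -/
def solutionProj (p : Jet) : Jet :=
  Sum.elim (fun μ => p (Sum.inl μ)) (fun α => reducedVar α p)

/-- The differential function that coincides with a given one on the solutions and does not depend
on the derivatives that involve differentiation with respect to `t`. -/
def restrictSol : DiffFun →ₐ[ℝ] DiffFun where
  toFun f := ⟨fun p => f (solutionProj p), by
    obtain ⟨S, g, hg, hf⟩ := f.2
    have h := isDiffFun_comp hg fun i : S => Sum.elim baseVar reducedVar i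
    have e : (fun p => f (solutionProj p))
        = fun p => g fun i : S => (Sum.elim baseVar reducedVar i : DiffFun) p := by
      funext p
      refine (hf _).trans (congrArg g (funext ?_))
      rintro ⟨μ | α, hi⟩ <;> rfl
    rw [e]
    exact h⟩
  map_one' := rfl
  map_mul' _ _ := rfl
  map_zero' := rfl
  map_add' _ _ := rfl
  commutes' _ := rfl

theorem restrictSol_eval (f : DiffFun) (p : Jet) : restrictSol f p = f (solutionProj p) := rfl

theorem restrictSol_jetVar (α : MultiIndex) : restrictSol (jetVar α) = reducedVar α := rfl

/-- Restriction of the coefficients of a symbol. -/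
def restrictSymbol : (MultiIndex →₀ DiffFun) →ₗ[ℝ] MultiIndex →₀ DiffFun :=
  Finsupp.mapRange.linearMap restrictSol.toLinearMap

theorem restrictSol_linearCombination (a : MultiIndex → DiffFun) (x : MultiIndex →₀ DiffFun) :
    restrictSol (Finsupp.linearCombination DiffFun a x)
      = Finsupp.linearCombination DiffFun (fun α => restrictSol (a α)) (restrictSymbol x) := by
  induction x using Finsupp.induction_linear with
  | zero => simp
  | add x y hx hy => simp only [map_add, hx, hy]
  | single α g => simp [restrictSymbol]

theorem partialD_restrictSol (i : JetIndex) (f : DiffFun) :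
    partialD i (restrictSol f)
      = ∑ ν, partialD i (baseVar ν) * restrictSol (partialD (Sum.inl ν) f)
        + Finsupp.linearCombination DiffFun (fun α => partialD i (reducedVar α))
          (restrictSymbol (vgrad f)) := by
  ext p
  have h := f.hasDerivAt_comp (c := fun s => solutionProj (Function.update p i s))
    (v := Sum.elim (fun ν => partialD i (baseVar ν) p) fun α => partialD i (reducedVar α) p)
    (s := p i) (by
      rintro (ν | α)
      · exact hasDerivAt_update_partialD i (baseVar ν) p
      · exact hasDerivAt_update_partialD i (reducedVar α) p)
  refine h.deriv.trans ?_
  rw [add_eval, sum_eval, Function.update_eq_self]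
  congr 1
  rw [Finsupp.linearCombination_apply, restrictSymbol, Finsupp.mapRange.linearMap_apply,
    Finsupp.sum_mapRange_index (by simp), Finsupp.sum, Finsupp.sum, sum_eval]
  refine Finset.sum_congr rfl fun α _ => ?_
  rw [smul_eq_mul, mul_eval, mul_comm]
  rfl

theorem vgrad_restrictSol (f : DiffFun) : vgrad (restrictSol f)
    = Finsupp.linearCombination DiffFun (fun α => vgrad (reducedVar α))
      (restrictSymbol (vgrad f)) := by
  ext1 β
  have h : ∀ x : MultiIndex →₀ DiffFun,
      Finsupp.linearCombination DiffFun (fun α => vgrad (reducedVar α)) x β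
        = Finsupp.linearCombination DiffFun (fun α => partialD (Sum.inr β) (reducedVar α)) x := by
    intro x
    induction x using Finsupp.induction_linear with
    | zero => simp
    | add x y hx hy => simp only [map_add, Finsupp.add_apply, hx, hy]
    | single α g => simp
  rw [h, vgrad_apply, partialD_restrictSol]
  simp [partialD_inr_baseVar]

theorem transport_restrictSol (ν : Fin 3) (a : MultiIndex → DiffFun) (f : DiffFun) :
    transport ν a (restrictSol f) = restrictSol (partialD (Sum.inl ν) f)
      + Finsupp.linearCombination DiffFun (fun α => transport ν a (reducedVar α))
        (restrictSymbol (vgrad f)) := by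
  have h : ∀ x : MultiIndex →₀ DiffFun,
      Finsupp.linearCombination DiffFun (fun α => transport ν a (reducedVar α)) x
        = Finsupp.linearCombination DiffFun (fun α => partialD (Sum.inl ν) (reducedVar α)) x
          + Finsupp.linearCombination DiffFun a
            (Finsupp.linearCombination DiffFun (fun α => vgrad (reducedVar α)) x) := by
    intro x
    induction x using Finsupp.induction_linear with
    | zero => simp
    | add x y hx hy => simp only [map_add, hx, hy]; abel
    | single α g => simp [transport_apply, mul_add]
  rw [h, transport_apply, vgrad_restrictSol, partialD_restrictSol]
  simp only [partialD_baseVar, ite_mul, one_mul, zero_mul, Finset.sum_ite_eq', Finset.mem_univ,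
    if_true]
  rw [add_assoc]

theorem reducedD_eq_transport (μ : Fin 3) : ∃ a, reducedD μ = transport μ a := by
  by_cases hμ : μ = 0
  · subst hμ; exact ⟨_, rfl⟩
  · exact ⟨_, (reducedD_of_ne_zero hμ).trans (totalD_eq_transport μ)⟩

/-- By the chain rule, it suffices to compare both sides on coordinates, where this is the recursion
that defines `reducedVar`. -/
theorem restrictSol_totalD (μ : Fin 3) (f : DiffFun) :
    restrictSol (totalD μ f) = reducedD μ (restrictSol f) := by
  obtain ⟨a, ha⟩ := reducedD_eq_transport μ
  rw [totalD_eq, map_add, restrictSol_linearCombination, ha, transport_restrictSol, ← ha]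
  simp only [restrictSol_jetVar, reducedVar_add_single]

theorem restrictSol_totalDIter (α : MultiIndex) (f : DiffFun) :
    restrictSol (totalDIter α f) = iter reducedD α (restrictSol f) := by
  induction α using multiIndex_induction with
  | h0 => rw [totalDIter_zero, iter_zero]; rfl
  | h α μ ih =>
    rw [totalDIter_add_single, restrictSol_totalD, ih, iter_add_single reducedD_comm]
    rfl

theorem reducedVar_of_eq_zero {α : MultiIndex} (hα : α 0 = 0) : reducedVar α = jetVar α := by
  have h : iter reducedD α = totalDIter α := by
    simp only [totalDIter, iter, hα, pow_zero]
    rfl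
  rw [reducedVar, h, totalDIter_jetVar, zero_add]

theorem restrictSol_burgers : restrictSol burgers = 0 := by
  have h : reducedVar ![1, 0, 0] = evolutionRHS := by
    have : reducedVar (0 + Pi.single 0 1) = reducedD 0 (reducedVar 0) := reducedVar_add_single 0 0
    rw [cons100, ← zero_add (Pi.single 0 1), this, reducedVar_of_eq_zero rfl]
    exact (transport_jetVar _ _ _).trans (totalDIter_zero _)
  rw [burgers_eq, map_sub, restrictSol_jetVar, h, evolutionRHS, map_sub, map_mul,
    restrictSol_jetVar, restrictSol_jetVar, restrictSol_jetVar, reducedVar_of_eq_zero rfl,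
    reducedVar_of_eq_zero rfl, reducedVar_of_eq_zero rfl, sub_self]

theorem solutionProj_mem (p : Jet) : solutionProj p ∈ solutionManifold := by
  intro α
  rw [← restrictSol_eval, restrictSol_totalDIter, restrictSol_burgers, map_zero]
  rfl

/-- The differential ideal generated by the left-hand side of the equation. -/
def burgersIdeal : Ideal DiffFun := Ideal.span (Set.range fun α => totalDIter α burgers)

theorem totalDIter_burgers_mem (α : MultiIndex) : totalDIter α burgers ∈ burgersIdeal :=
  Ideal.subset_span ⟨α, rfl⟩

theorem totalD_mem_burgersIdeal (μ : Fin 3) {f : DiffFun} (hf : f ∈ burgersIdeal) :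
    totalD μ f ∈ burgersIdeal := by
  induction hf using Submodule.span_induction with
  | mem f hf =>
    obtain ⟨α, rfl⟩ := hf
    exact totalDIter_add_single α μ burgers ▸ totalDIter_burgers_mem _
  | zero => rw [map_zero]; exact zero_mem _
  | add f g _ _ hf hg => rw [map_add]; exact add_mem hf hg
  | smul a f hf' hf =>
    rw [smul_eq_mul, totalD_mul]
    exact add_mem (Ideal.mul_mem_left _ _ hf') (Ideal.mul_mem_left _ _ hf)

theorem eval_of_mem_burgersIdeal {f : DiffFun} (hf : f ∈ burgersIdeal) {p : Jet}
    (hp : p ∈ solutionManifold) : f p = 0 := by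
  have h : burgersIdeal ≤ RingHom.ker (evalAt p) := by
    refine Ideal.span_le.2 ?_
    rintro _ ⟨α, rfl⟩
    exact hp α
  exact h hf

theorem mem_vanishing_of_mem_burgersIdeal {f : DiffFun} (hf : f ∈ burgersIdeal) :
    f ∈ vanishing := fun _ hp => eval_of_mem_burgersIdeal hf hp

/-- The two fields differ only in the u_α-components, by D^α u_t - D^α(u_yy - u u_x) = D^α L. -/
theorem totalD_zero_sub_evolutionD (f : DiffFun) : totalD 0 f - evolutionD f
    = Finsupp.linearCombination DiffFun (fun α => totalDIter α burgers) (vgrad f) := by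
  have h : ∀ x : MultiIndex →₀ DiffFun,
      Finsupp.linearCombination DiffFun (fun α => totalDIter α burgers) x
        = Finsupp.linearCombination DiffFun (fun α => jetVar (α + Pi.single 0 1)) x
          - Finsupp.linearCombination DiffFun (fun α => totalDIter α evolutionRHS) x := by
    intro x
    induction x using Finsupp.induction_linear with
    | zero => simp
    | add x y hx hy => simp only [map_add, hx, hy]; abel
    | single α g =>
      simp only [Finsupp.linearCombination_single, burgers_eq, map_sub, totalDIter_jetVar, cons100,
        smul_sub, add_comm α]
  rw [h, totalD_eq, evolutionD, transport_apply]
  abel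

theorem linearCombination_mem_burgersIdeal {a : MultiIndex → DiffFun}
    (ha : ∀ α, a α ∈ burgersIdeal) (x : MultiIndex →₀ DiffFun) :
    Finsupp.linearCombination DiffFun a x ∈ burgersIdeal :=
  sum_mem fun _ _ => Ideal.mul_mem_left _ _ (ha _)

/-- Each replacement of D_t by `evolutionD` costs a combination of the functions D^α L, and the
ideal is stable under D_μ. Hence the projection fixes every point of the solution manifold. -/
theorem reducedVar_sub_jetVar_mem (α : MultiIndex) : jetVar α - reducedVar α ∈ burgersIdeal := by
  induction α using multiIndex_induction with
  | h0 => rw [reducedVar_of_eq_zero rfl, sub_self]; exact zero_mem _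
  | h α μ ih =>
    have h1 := totalD_mem_burgersIdeal μ ih
    rw [map_sub, totalD_jetVar] at h1
    have h2 : totalD μ (reducedVar α) - reducedD μ (reducedVar α) ∈ burgersIdeal := by
      by_cases hμ : μ = 0
      · subst hμ
        exact totalD_zero_sub_evolutionD (reducedVar α) ▸
          linearCombination_mem_burgersIdeal totalDIter_burgers_mem _
      · rw [reducedD_of_ne_zero hμ, sub_self]; exact zero_mem _
    have h3 := add_mem h1 h2
    rwa [sub_add_sub_cancel, ← reducedVar_add_single] at h3

theorem solutionProj_of_mem {p : Jet} (hp : p ∈ solutionManifold) : solutionProj p = p := by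
  funext i
  rcases i with μ | α
  · rfl
  · exact (sub_eq_zero.1 (eval_of_mem_burgersIdeal (reducedVar_sub_jetVar_mem α) hp)).symm

/-- `solutionProj` is a retraction: it takes values in the solution manifold and fixes its points.
-/
theorem mem_vanishing_iff {f : DiffFun} : f ∈ vanishing ↔ restrictSol f = 0 := by
  refine ⟨fun h => DiffFun.ext fun p => h _ (solutionProj_mem p), fun h p hp => ?_⟩
  have := congrArg (fun g : DiffFun => g p) h
  rwa [restrictSol_eval, solutionProj_of_mem hp] at this

theorem totalD_mem_vanishing (μ : Fin 3) {f : DiffFun} (hf : f ∈ vanishing) :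
    totalD μ f ∈ vanishing := by
  rw [mem_vanishing_iff] at hf ⊢
  rw [restrictSol_totalD, hf, map_zero]

theorem restrictSol_restrictSol (f : DiffFun) : restrictSol (restrictSol f) = restrictSol f := by
  ext p
  rw [restrictSol_eval, restrictSol_eval, restrictSol_eval,
    solutionProj_of_mem (solutionProj_mem p)]

theorem sub_restrictSol_mem (f : DiffFun) : f - restrictSol f ∈ vanishing := by
  rw [mem_vanishing_iff, map_sub, restrictSol_restrictSol, sub_self]

/-! ### Functions of the parametric derivatives -/

theorem partialD_one (i : JetIndex) : partialD i 1 = 0 := by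
  have h := partialD_mul i 1 1
  simpa using h

/-- The differential functions that do not depend on the derivatives of `u` that involve
differentiation with respect to `t`. -/
def freeFun : Subalgebra ℝ DiffFun where
  carrier := {f | ∀ α : MultiIndex, α 0 ≠ 0 → partialD (Sum.inr α) f = 0}
  mul_mem' {f g} hf hg α hα := by rw [partialD_mul, hf α hα, hg α hα]; simp
  add_mem' {f g} hf hg α hα := by rw [map_add, hf α hα, hg α hα, add_zero]
  algebraMap_mem' c α _ := by rw [Algebra.algebraMap_eq_smul_one, map_smul, partialD_one, smul_zero]

theorem totalD_mem_freeFun {μ : Fin 3} (hμ : μ ≠ 0) {f : DiffFun} (hf : f ∈ freeFun) :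
    totalD μ f ∈ freeFun := by
  intro α hα
  rcases multiIndex_cases α μ with h | ⟨β, rfl⟩
  · rw [partialD_totalD_of_eq_zero h, hf α hα, map_zero]
  · rw [partialD_totalD_add, hf _ hα, map_zero, zero_add]
    exact hf β (by simpa [hμ.symm] using hα)

theorem partialD_mem_freeFun (i : JetIndex) {f : DiffFun} (hf : f ∈ freeFun) :
    partialD i f ∈ freeFun := fun α hα => by rw [partialD_comm, hf α hα, map_zero]

theorem jetVar_mem_freeFun {α : MultiIndex} (hα : α 0 = 0) : jetVar α ∈ freeFun := by
  intro β hβ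
  rw [partialD_jetVar, if_neg]
  rintro rfl
  exact hβ hα

theorem pow_totalD_mem_freeFun {μ : Fin 3} (hμ : μ ≠ 0) {f : DiffFun} (hf : f ∈ freeFun) (n : ℕ) :
    (totalD μ ^ n) f ∈ freeFun := by
  induction n with
  | zero => exact hf
  | succ n ih => rw [pow_succ']; exact totalD_mem_freeFun hμ ih

theorem totalDIter_mem_freeFun {α : MultiIndex} (hα : α 0 = 0) {f : DiffFun} (hf : f ∈ freeFun) :
    totalDIter α f ∈ freeFun := by
  have h : totalDIter α f = (totalD 1 ^ α 1) ((totalD 2 ^ α 2) f) := by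
    simp [totalDIter, hα]
  rw [h]
  exact pow_totalD_mem_freeFun (by decide) (pow_totalD_mem_freeFun (by decide) hf _) _

theorem evolutionRHS_mem_freeFun : evolutionRHS ∈ freeFun :=
  sub_mem (jetVar_mem_freeFun rfl) (mul_mem (jetVar_mem_freeFun rfl) (jetVar_mem_freeFun rfl))

theorem evolutionD_mem_freeFun {f : DiffFun} (hf : f ∈ freeFun) : evolutionD f ∈ freeFun := by
  rw [evolutionD, transport_apply, Finsupp.linearCombination_apply]
  refine add_mem (partialD_mem_freeFun _ hf) (sum_mem fun α _ => ?_)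
  by_cases hα : α 0 = 0
  · exact mul_mem (partialD_mem_freeFun _ hf) (totalDIter_mem_freeFun hα evolutionRHS_mem_freeFun)
  · simp [hf α hα]

theorem reducedVar_mem_freeFun (α : MultiIndex) : reducedVar α ∈ freeFun := by
  induction α using multiIndex_induction with
  | h0 => exact reducedVar_of_eq_zero (α := 0) rfl ▸ jetVar_mem_freeFun rfl
  | h α μ ih =>
    rw [reducedVar_add_single]
    by_cases hμ : μ = 0
    · subst hμ; exact evolutionD_mem_freeFun ih
    · rw [reducedD_of_ne_zero hμ]; exact totalD_mem_freeFun hμ ih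

theorem restrictSol_mem_freeFun (f : DiffFun) : restrictSol f ∈ freeFun := by
  intro α hα
  have h : (fun β => partialD (Sum.inr α) (reducedVar β)) = 0 :=
    funext fun β => reducedVar_mem_freeFun β α hα
  rw [partialD_restrictSol, h]
  simp [partialD_inr_baseVar]

theorem restrictSol_of_mem_freeFun {f : DiffFun} (hf : f ∈ freeFun) : restrictSol f = f := by
  ext p
  rw [restrictSol_eval]
  refine DiffFun.eq_of_partialD_eq_zero (I := {i | ∀ α : MultiIndex, i = Sum.inr α → α 0 = 0})
    ?_ ?_
  · intro i hi
    simp only [Set.mem_ofPred_eq, not_forall] at hi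
    obtain ⟨α, rfl, hα⟩ := hi
    exact hf α hα
  · rintro (μ | α) hi
    · rfl
    · exact congrArg (fun g : DiffFun => g p) (reducedVar_of_eq_zero (hi α rfl))

/-- Functions without t-derivatives are their own restrictions, so each coset modulo `vanishing` has
only one such representative. -/
theorem eq_zero_of_mem_freeFun {f : DiffFun} (hf : f ∈ freeFun) (hf' : f ∈ vanishing) : f = 0 := by
  rw [← restrictSol_of_mem_freeFun hf, mem_vanishing_iff.1 hf']

/-! ### Cosymmetries -/

/-- The operator `γ ↦ D_t γ + u D_x γ + D_y² γ` in view of the equation. -/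
def reducedCosymmetryOp (f : DiffFun) : DiffFun :=
  evolutionD f + jetVar ![0, 0, 0] * totalD 1 f + totalD 2 (totalD 2 f)

theorem cosymmetryOp_apply (f : DiffFun) : cosymmetryOp f
    = totalD 0 f + jetVar ![0, 0, 0] * totalD 1 f + totalD 2 (totalD 2 f) := rfl

theorem restrictSol_cosymmetryOp (f : DiffFun) :
    restrictSol (cosymmetryOp f) = reducedCosymmetryOp (restrictSol f) := by
  rw [cosymmetryOp_apply, map_add, map_add, map_mul, restrictSol_totalD, restrictSol_totalD,
    restrictSol_totalD, restrictSol_totalD, restrictSol_jetVar, reducedVar_of_eq_zero rfl]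
  rfl

/-- D^α raises the order in y by at most α_2. -/
theorem partialD_totalDIter_eq_zero {f : DiffFun} {m : ℕ}
    (hf : ∀ β : MultiIndex, m < β 2 → partialD (Sum.inr β) f = 0) (α : MultiIndex) :
    ∀ β : MultiIndex, m + α 2 < β 2 → partialD (Sum.inr β) (totalDIter α f) = 0 := by
  induction α using multiIndex_induction with
  | h0 => rw [totalDIter_zero]; exact hf
  | h α μ ih =>
    intro β hβ
    rw [totalDIter_add_single]
    simp only [Pi.add_apply] at hβ
    rcases multiIndex_cases β μ with h | ⟨β, rfl⟩
    · rw [partialD_totalD_of_eq_zero h, ih β (by omega), map_zero]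
    · simp only [Pi.add_apply] at hβ
      rw [partialD_totalD_add, ih _ (by simp only [Pi.add_apply]; omega), ih β (by omega), map_zero,
        add_zero]

/-- The term u u_x has order 0 in y, so only u_yy can contribute in these high orders. -/
theorem partialD_totalDIter_evolutionRHS {δ β : MultiIndex} (h : δ 2 + 1 < β 2) :
    partialD (Sum.inr β) (totalDIter δ evolutionRHS) = if ![0, 0, 2] + δ = β then 1 else 0 := by
  have h0 : partialD (Sum.inr β) (totalDIter δ (jetVar ![0, 0, 0] * jetVar ![0, 1, 0])) = 0 := by
    refine partialD_totalDIter_eq_zero (m := 0) (fun β hβ => ?_) δ β (by omega)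
    rw [partialD_mul, partialD_jetVar, partialD_jetVar, if_neg, if_neg]
    · simp
    · rintro rfl; simp at hβ
    · rintro rfl; simp at hβ
  rw [evolutionRHS, map_sub, map_sub, h0, totalDIter_jetVar, partialD_jetVar, sub_zero]

/-- Differentiation with respect to u_{α+2ε_2} isolates the top order in y. The terms D_t g and D_y²
g give ∂g/∂u_α each, and u D_x g gives nothing, as D_x does not raise the order in y. -/
theorem partialD_eq_zero_of_reducedCosymmetryOp {g : DiffFun} (hg : reducedCosymmetryOp g = 0)
    {n : ℕ} (hn : ∀ α : MultiIndex, n + 1 ≤ α 2 → partialD (Sum.inr α) g = 0)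
    {α : MultiIndex} (hα : α 2 = n) : partialD (Sum.inr α) g = 0 := by
  obtain ⟨β, hβ⟩ : ∃ β : MultiIndex, β = α + Pi.single 2 1 + Pi.single 2 1 := ⟨_, rfl⟩
  have hβ2 : β 2 = n + 2 := by simp [hβ, hα]
  have hgβ : partialD (Sum.inr β) g = 0 := hn β (by omega)
  have h2 : partialD (Sum.inr β) (totalD 2 (totalD 2 g)) = partialD (Sum.inr α) g := by
    have h : partialD (Sum.inr (α + Pi.single 2 1)) g = 0 := hn _ (by simp [hα])
    have hgβ' := hgβ
    rw [hβ] at hgβ'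
    rw [hβ, partialD_totalD_add, partialD_totalD_add, partialD_totalD_add, h, hgβ']
    simp
  have h1 : partialD (Sum.inr β) (jetVar ![0, 0, 0] * totalD 1 g) = 0 := by
    have h : partialD (Sum.inr β) (totalD 1 g) = 0 := by
      rcases multiIndex_cases β 1 with h | ⟨κ, rfl⟩
      · rw [partialD_totalD_of_eq_zero h, hgβ, map_zero]
      · have hκ : κ 2 = n + 2 := by simpa using hβ2
        rw [partialD_totalD_add, hgβ, map_zero, zero_add, hn κ (by omega)]
    rw [partialD_mul, h, partialD_jetVar, if_neg]
    · simp
    · rintro rfl; simp at hβ2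
  have h0 : partialD (Sum.inr β) (evolutionD g) = partialD (Sum.inr α) g := by
    rw [evolutionD, transport_apply, map_add, partialD_linearCombination, mapRange_partialD_vgrad,
      partialD_comm, hgβ, map_zero, map_zero, map_zero, zero_add, add_zero,
      -- Terms with δ_2 > n vanish by hypothesis; for the others, D^δ u_yy is the coordinate u_β
      -- only if δ = α.
      Finsupp.linearCombination_apply, Finsupp.sum, Finset.sum_eq_single α]
    · rw [partialD_totalDIter_evolutionRHS (by omega), if_pos]
      · simp
      · rw [hβ, cons002, add_comm, add_assoc]
    · intro δ _ hδ
      by_cases h : n + 1 ≤ δ 2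
      · simp [hn δ h]
      · rw [partialD_totalDIter_evolutionRHS (by omega), if_neg, smul_zero]
        rw [hβ, cons002, add_comm, add_assoc]
        exact fun h => hδ (add_right_cancel h)
    · intro h
      rw [Finsupp.notMem_support_iff.1 h, zero_smul]
  have h := congrArg (partialD (Sum.inr β)) hg
  rw [reducedCosymmetryOp, map_add, map_add, h0, h1, h2, add_zero, map_zero, ← two_smul ℝ] at h
  exact (smul_eq_zero.1 h).resolve_left two_ne_zero

theorem vgrad_eq_zero_of_reducedCosymmetryOp {g : DiffFun} (hg : reducedCosymmetryOp g = 0) :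
    vgrad g = 0 := by
  have key : ∀ n, (∀ α : MultiIndex, n ≤ α 2 → partialD (Sum.inr α) g = 0) →
      ∀ α : MultiIndex, partialD (Sum.inr α) g = 0 := by
    intro n
    induction n with
    | zero => exact fun h α => h α (Nat.zero_le _)
    | succ n ih =>
      refine fun h => ih fun α hα => ?_
      rcases hα.eq_or_lt with hα | hα
      · exact partialD_eq_zero_of_reducedCosymmetryOp hg h hα.symm
      · exact h α hα
  -- The descent starts one above the highest order in y that occurs in g.
  refine Finsupp.ext (key ((vgrad g).support.sup (fun α => α 2) + 1) fun α hα => ?_)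
  by_contra h
  have := Finset.le_sup (f := fun α : MultiIndex => α 2)
    ((Finsupp.mem_support_iff (f := vgrad g)).2 h)
  omega

theorem reducedCosymmetryOp_of_vgrad_eq_zero {g : DiffFun} (hg : vgrad g = 0) :
    reducedCosymmetryOp g = partialD (Sum.inl 0) g + jetVar ![0, 0, 0] * partialD (Sum.inl 1) g
      + partialD (Sum.inl 2) (partialD (Sum.inl 2) g) := by
  rw [reducedCosymmetryOp, evolutionD, transport_apply, hg, map_zero, add_zero,
    totalD_of_vgrad_eq_zero 1 hg, totalD_of_vgrad_eq_zero 2 hg,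
    totalD_of_vgrad_eq_zero 2 (vgrad_partialD_inl 2 hg)]

theorem heatToDiffFun_eval (γ : backwardHeat) (p : Jet) :
    heatToDiffFun γ p = γ.1 (p (Sum.inl 0), p (Sum.inl 2)) := rfl

theorem vgrad_heatToDiffFun (γ : backwardHeat) : vgrad (heatToDiffFun γ) = 0 := by
  ext1 α
  ext p
  rw [vgrad_apply, partialD_eval]
  simp [heatToDiffFun_eval]

theorem partialD_one_heatToDiffFun (γ : backwardHeat) :
    partialD (Sum.inl 1) (heatToDiffFun γ) = 0 := by
  ext p
  rw [partialD_eval]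
  simp [heatToDiffFun_eval]

theorem partialD_heatToDiffFun (γ : backwardHeat) : partialD (Sum.inl 0) (heatToDiffFun γ)
    + partialD (Sum.inl 2) (partialD (Sum.inl 2) (heatToDiffFun γ)) = 0 := by
  have h0 : ∀ p, partialD (Sum.inl 0) (heatToDiffFun γ) p
      = deriv (fun s => γ.1 (s, p (Sum.inl 2))) (p (Sum.inl 0)) := fun p => by
    rw [partialD_eval]
    simp [heatToDiffFun_eval]
  have h2 : ∀ p, partialD (Sum.inl 2) (heatToDiffFun γ) p
      = deriv (fun s => γ.1 (p (Sum.inl 0), s)) (p (Sum.inl 2)) := fun p => by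
    rw [partialD_eval]
    simp [heatToDiffFun_eval]
  ext p
  rw [add_eval, h0, partialD_eval]
  simp only [h2]
  have h := γ.2.2 (p (Sum.inl 0)) (p (Sum.inl 2))
  rw [iteratedDeriv_eq_iterate] at h
  simpa using h

/-- The point of the jet space with given coordinates `t` and `y` all of whose other coordinates are
zero. -/
def basePoint (t y : ℝ) : Jet := Sum.elim ![t, 0, y] fun _ => 0

theorem exists_heatToDiffFun_eq {g : DiffFun} (hg : vgrad g = 0)
    (h1 : partialD (Sum.inl 1) g = 0)
    (h : partialD (Sum.inl 0) g + partialD (Sum.inl 2) (partialD (Sum.inl 2) g) = 0) :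
    ∃ γ, heatToDiffFun γ = g := by
  have e0 : ∀ t y s, Function.update (basePoint t y) (Sum.inl 0) s = basePoint s y := by
    intro t y s
    funext i
    rcases i with i | α
    · fin_cases i <;> simp [basePoint]
    · simp [basePoint]
  have e2 : ∀ t y s, Function.update (basePoint t y) (Sum.inl 2) s = basePoint t s := by
    intro t y s
    funext i
    rcases i with i | α
    · fin_cases i <;> simp [basePoint]
    · simp [basePoint]
  have d2 : ∀ (f : DiffFun) (t y : ℝ), deriv (fun s => f (basePoint t s)) y
      = partialD (Sum.inl 2) f (basePoint t y) := by
    intro f t y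
    rw [partialD_eval]
    simp only [e2]
    rfl
  -- The values x = 0 and u_α = 0 are immaterial, because g does not depend on these coordinates.
  refine ⟨⟨fun q => g (basePoint q.1 q.2), ?_, fun t y => ?_⟩, ?_⟩
  · refine g.contDiff_comp ?_
    rintro (i | α)
    · fin_cases i
      · exact contDiff_fst
      · exact contDiff_const
      · exact contDiff_snd
    · exact contDiff_const
  · have h0 : deriv (fun s => g (basePoint s y)) t = partialD (Sum.inl 0) g (basePoint t y) := by
      rw [partialD_eval]
      simp only [e0]
      rfl
    have hh := congrArg (fun f : DiffFun => f (basePoint t y)) h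
    rw [iteratedDeriv_eq_iterate]
    simp only [Function.iterate_succ, Function.iterate_zero, Function.comp_apply, id_eq]
    have d2' : deriv (fun s => g (basePoint t s))
        = fun y => partialD (Sum.inl 2) g (basePoint t y) := funext fun y => d2 g t y
    rw [h0, d2', d2]
    exact hh
  · ext p
    refine DiffFun.eq_of_partialD_eq_zero (f := g) (I := {Sum.inl 0, Sum.inl 2})
      (p := basePoint (p (Sum.inl 0)) (p (Sum.inl 2))) ?_ ?_
    · rintro (i | α) hi
      · fin_cases i
        · simp at hi
        · exact h1
        · simp at hi
      · exact partialD_inr_of_vgrad_eq_zero α hg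
    · rintro i (rfl | rfl) <;> rfl

theorem exists_heatToDiffFun_eq_restrictSol {f : DiffFun} (hf : f ∈ cosymmetries) :
    ∃ γ, heatToDiffFun γ = restrictSol f := by
  have h : reducedCosymmetryOp (restrictSol f) = 0 := by
    rw [← restrictSol_cosymmetryOp, ← mem_vanishing_iff]
    exact hf
  have hv := vgrad_eq_zero_of_reducedCosymmetryOp h
  rw [reducedCosymmetryOp_of_vgrad_eq_zero hv] at h
  have h1 : partialD (Sum.inl 1) (restrictSol f) = 0 := by
    -- The condition is now affine in u with coefficients depending on t, x, y; the coefficient of u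
    -- is g_x.
    have h' := congrArg (partialD (Sum.inr ![0, 0, 0])) h
    rw [map_add, map_add, partialD_inr_of_vgrad_eq_zero _ (vgrad_partialD_inl 0 hv),
      partialD_inr_of_vgrad_eq_zero _ (vgrad_partialD_inl 2 (vgrad_partialD_inl 2 hv)),
      partialD_mul, partialD_inr_of_vgrad_eq_zero _ (vgrad_partialD_inl 1 hv), partialD_jetVar,
      if_pos rfl] at h'
    simpa using h'
  rw [h1, mul_zero, add_zero] at h
  exact exists_heatToDiffFun_eq hv h1 h

theorem heatToDiffFun_mem_freeFun (γ : backwardHeat) : heatToDiffFun γ ∈ freeFun :=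
  fun α _ => partialD_inr_of_vgrad_eq_zero α (vgrad_heatToDiffFun γ)

theorem heatToDiffFun_injective : Function.Injective heatToDiffFun := by
  intro γ δ h
  refine Subtype.ext (funext fun q => ?_)
  exact congrArg (fun f : DiffFun => f (basePoint q.1 q.2)) h

theorem heatToDiffFun_mem_cosymmetries (γ : backwardHeat) : heatToDiffFun γ ∈ cosymmetries := by
  have hv := vgrad_heatToDiffFun γ
  change cosymmetryOp _ ∈ vanishing
  have h : cosymmetryOp (heatToDiffFun γ) = 0 := by
    rw [cosymmetryOp_apply, totalD_of_vgrad_eq_zero _ hv, totalD_of_vgrad_eq_zero _ hv,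
      totalD_of_vgrad_eq_zero _ hv, totalD_of_vgrad_eq_zero _ (vgrad_partialD_inl 2 hv),
      partialD_one_heatToDiffFun, mul_zero, add_zero, partialD_heatToDiffFun]
  rw [h]
  exact zero_mem _

/-! ### Characteristics -/

theorem totalDiv_apply (F : Current) :
    totalDiv F = totalD 0 (F 0) + totalD 1 (F 1) + totalD 2 (F 2) := by
  simp [totalDiv, Fin.sum_univ_three]

/-- The symbol of the Euler operator. -/
def eulerSymbol (f : DiffFun) : MultiIndex →₀ DiffFun :=
  symbolRem 0 (symbolRem 1 (symbolRem 2 (vgrad f)))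

theorem eulerSymbol_totalDiv (F : Current) : eulerSymbol (totalDiv F) = 0 := by
  simp only [eulerSymbol, totalDiv_apply, map_add, vgrad_totalD, symbolRem_symbolD_self,
    symbolRem_symbolD (show (2 : Fin 3) ≠ 0 by decide),
    symbolRem_symbolD (show (2 : Fin 3) ≠ 1 by decide),
    symbolRem_symbolD (show (1 : Fin 3) ≠ 0 by decide), add_zero]

theorem symbolRem_symbolRem_symbolRem_single (α : MultiIndex) (g : DiffFun) :
    symbolRem 0 (symbolRem 1 (symbolRem 2 (Finsupp.single α g)))
      = Finsupp.single 0 (((-totalD 0) ^ α 0) (((-totalD 1) ^ α 1) (((-totalD 2) ^ α 2) g))) := by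
  rw [symbolRem_single, symbolRem_single, symbolRem_single]
  congr 1
  funext μ
  fin_cases μ <;> simp

/-- Taking remainders only applies powers of -D_μ to coefficients and adds them. This is used both
for the differential ideal of L and for functions free of t-derivatives. -/
theorem symbolRem_mem {μ : Fin 3} {N : Submodule ℝ DiffFun} (hN : ∀ g ∈ N, totalD μ g ∈ N)
    {x : MultiIndex →₀ DiffFun} (hx : ∀ α, x α ∈ N) (β : MultiIndex) : symbolRem μ x β ∈ N := by
  have hpow : ∀ (n : ℕ) (g : DiffFun), g ∈ N → ((-totalD μ) ^ n) g ∈ N := by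
    intro n g hg
    induction n with
    | zero => exact hg
    | succ n ih =>
      rw [pow_succ']
      exact neg_mem (hN _ ih)
  rw [← Finsupp.sum_single x, Finsupp.sum, map_sum, Finsupp.finsetSum_apply]
  refine sum_mem fun α _ => ?_
  rw [symbolRem_single, Finsupp.single_apply]
  split_ifs
  · exact hpow _ _ (hx α)
  · exact zero_mem _

theorem vgrad_burgers : vgrad burgers = Finsupp.single ![1, 0, 0] 1
    + (Finsupp.single ![0, 0, 0] (jetVar ![0, 1, 0])
      + Finsupp.single ![0, 1, 0] (jetVar ![0, 0, 0]))
    - Finsupp.single ![0, 0, 2] 1 := by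
  simp [burgers, vgrad_mul, vgrad_jetVar]

/-- By the product rule, the linearization of γL has a part with coefficients divisible by L and γ
times the linearization of L. The remainder of the latter is the formal adjoint applied to γ, where
-D_x(uγ) + u_x γ = -u D_x γ. -/
theorem eulerSymbol_mul_burgers (γ : DiffFun) : eulerSymbol (γ * burgers)
    = symbolRem 0 (symbolRem 1 (symbolRem 2 (burgers • vgrad γ)))
      - Finsupp.single 0 (cosymmetryOp γ) := by
  have h : totalD 1 (jetVar ![0, 0, 0]) = jetVar ![0, 1, 0] := by
    rw [totalD_jetVar, cons010, cons000, zero_add]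
  rw [eulerSymbol, vgrad_mul, map_add, map_add, map_add, sub_eq_add_neg]
  congr 1
  simp only [vgrad_burgers, smul_add, smul_sub, Finsupp.smul_single, map_add, map_sub,
    symbolRem_symbolRem_symbolRem_single, ← Finsupp.single_add, ← Finsupp.single_sub,
    ← Finsupp.single_neg]
  congr 1
  simp [cosymmetryOp_apply, totalD_mul, h, pow_succ]
  ring

/-- The Euler operator annihilates γL, so the cosymmetry operator on γ equals the remainder of the
part divisible by L, which lies in the differential ideal. -/
theorem characteristics_le_cosymmetries : characteristics ≤ cosymmetries := by
  rintro γ ⟨F, hF⟩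
  change totalDiv F = γ * burgers at hF
  have h := eulerSymbol_totalDiv F
  rw [hF, eulerSymbol_mul_burgers, sub_eq_zero] at h
  have h' := DFunLike.congr_fun h 0
  rw [Finsupp.single_eq_same] at h'
  refine mem_vanishing_of_mem_burgersIdeal ?_
  rw [← h']
  have hN : ∀ μ, ∀ g ∈ burgersIdeal.restrictScalars ℝ,
      totalD μ g ∈ burgersIdeal.restrictScalars ℝ :=
    fun μ _ hg => totalD_mem_burgersIdeal μ hg
  refine symbolRem_mem (hN 0) (symbolRem_mem (hN 1) (symbolRem_mem (hN 2) fun α => ?_)) 0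
  exact Ideal.mul_mem_right _ _ (totalDIter_zero burgers ▸ totalDIter_burgers_mem 0)

theorem totalDiv_heatCurrent (γ : backwardHeat) :
    totalDiv (heatCurrent γ) = heatToDiffFun γ * burgers := by
  have hv := vgrad_heatToDiffFun γ
  have h0 : totalD 0 (jetVar ![0, 0, 0]) = jetVar ![1, 0, 0] := by
    rw [totalD_jetVar, cons100, cons000, zero_add]
  have h1 : totalD 1 (jetVar ![0, 0, 0]) = jetVar ![0, 1, 0] := by
    rw [totalD_jetVar, cons010, cons000, zero_add]
  have h2 : totalD 2 (jetVar ![0, 0, 0]) = jetVar ![0, 0, 1] := by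
    rw [totalD_jetVar, cons001, cons000, zero_add]
  have h3 : totalD 2 (jetVar ![0, 0, 1]) = jetVar ![0, 0, 2] := by
    rw [totalD_jetVar, cons001, cons002]
  have hh := partialD_heatToDiffFun γ
  have c0 : heatCurrent γ 0 = heatToDiffFun γ * jetVar ![0, 0, 0] := rfl
  have c1 : heatCurrent γ 1 = (1 / 2 : ℝ) • (heatToDiffFun γ * jetVar ![0, 0, 0] ^ 2) := rfl
  have c2 : heatCurrent γ 2 = partialD (Sum.inl 2) (heatToDiffFun γ) * jetVar ![0, 0, 0]
      - heatToDiffFun γ * jetVar ![0, 0, 1] := rfl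
  rw [totalDiv_apply, c0, c1, c2]
  rw [map_smul, map_sub, pow_two, totalD_mul, totalD_mul, totalD_mul, totalD_mul, totalD_mul,
    h0, h1, h2, h3, totalD_of_vgrad_eq_zero 0 hv, totalD_of_vgrad_eq_zero 1 hv,
    totalD_of_vgrad_eq_zero 2 hv, totalD_of_vgrad_eq_zero 2 (vgrad_partialD_inl 2 hv),
    partialD_one_heatToDiffFun, burgers]
  have e : (1 / 2 : ℝ) • (0 * (jetVar ![0, 0, 0] * jetVar ![0, 0, 0])
      + heatToDiffFun γ * (jetVar ![0, 1, 0] * jetVar ![0, 0, 0]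
        + jetVar ![0, 0, 0] * jetVar ![0, 1, 0]))
      = heatToDiffFun γ * (jetVar ![0, 0, 0] * jetVar ![0, 1, 0]) := by
    ext p
    simp only [smul_eval, add_eval, mul_eval, zero_eval]
    ring
  rw [e]
  -- The divergence exceeds γL by u(γ_t + γ_yy), which is zero.
  linear_combination jetVar ![0, 0, 0] * hh

theorem heatToDiffFun_mem_characteristics (γ : backwardHeat) :
    heatToDiffFun γ ∈ characteristics := ⟨heatCurrent γ, totalDiv_heatCurrent γ⟩

/-! ### Conservation laws -/

/-- The remainders in x and y remove the last two terms of the linearized divergence. What is left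
is D_t composed with the variational derivative of the density, and composition with D_t is
injective. -/
theorem symbolRem_vgrad_of_totalDiv_eq_zero {K : Current} (hK : totalDiv K = 0) :
    symbolRem 1 (symbolRem 2 (vgrad (K 0))) = 0 := by
  have h := congrArg (fun f => symbolRem 1 (symbolRem 2 (vgrad f))) hK
  simp only [totalDiv_apply, map_add, vgrad_totalD, symbolRem_symbolD_self,
    symbolRem_symbolD (show (2 : Fin 3) ≠ 0 by decide),
    symbolRem_symbolD (show (2 : Fin 3) ≠ 1 by decide),
    symbolRem_symbolD (show (1 : Fin 3) ≠ 0 by decide), map_zero, add_zero] at h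
  exact symbolD_eq_zero h

theorem vgrad_heatToDiffFun_mul (γ : backwardHeat) :
    vgrad (heatToDiffFun γ * jetVar ![0, 0, 0]) = Finsupp.single 0 (heatToDiffFun γ) := by
  rw [vgrad_mul, vgrad_heatToDiffFun, smul_zero, zero_add, vgrad_jetVar, cons000]
  simp

theorem symbolRem_single_zero (μ : Fin 3) (g : DiffFun) :
    symbolRem μ (Finsupp.single 0 g) = Finsupp.single 0 g := by
  rw [symbolRem_single, show Function.update (0 : MultiIndex) μ 0 = 0 from
    Function.update_eq_self μ (0 : MultiIndex)]
  rfl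

theorem burgers_mem_burgersIdeal : burgers ∈ burgersIdeal :=
  totalDIter_zero burgers ▸ totalDIter_burgers_mem 0

theorem heatCurrent_mem_conservedCurrents (γ : backwardHeat) :
    heatCurrent γ ∈ conservedCurrents := by
  change totalDiv _ ∈ vanishing
  rw [totalDiv_heatCurrent]
  exact mem_vanishing_of_mem_burgersIdeal (Ideal.mul_mem_left _ _ burgers_mem_burgersIdeal)

/-- The density of a null divergence is D_x A + D_y B, and restriction preserves this form, so γu is
such a divergence. Its variational derivative γ is therefore zero. -/
theorem eq_zero_of_heatCurrent_mem_trivialCurrents {γ : backwardHeat}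
    (h : heatCurrent γ ∈ trivialCurrents) : γ = 0 := by
  obtain ⟨V, hV, K, hK, hVK⟩ := Submodule.mem_sup.1 h
  obtain ⟨A, B, hAB⟩ := exists_eq_totalD_add (symbolRem_vgrad_of_totalDiv_eq_zero hK)
  have h0 : V 0 + K 0 = heatToDiffFun γ * jetVar ![0, 0, 0] := congrFun hVK 0
  have h1 := congrArg restrictSol h0
  rw [map_add, mem_vanishing_iff.1 (hV 0 (Set.mem_univ _)), zero_add, hAB, map_add,
    restrictSol_totalD, restrictSol_totalD, reducedD_of_ne_zero (by decide),
    reducedD_of_ne_zero (by decide), restrictSol_of_mem_freeFun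
      (mul_mem (heatToDiffFun_mem_freeFun γ) (jetVar_mem_freeFun rfl))] at h1
  have h2 := congrArg (fun f => symbolRem 1 (symbolRem 2 (vgrad f))) h1
  simp only [map_add, vgrad_totalD, symbolRem_symbolD_self,
    symbolRem_symbolD (show (2 : Fin 3) ≠ 1 by decide), add_zero,
    vgrad_heatToDiffFun_mul, symbolRem_single_zero] at h2
  refine heatToDiffFun_injective ?_
  rw [map_zero]
  exact Finsupp.single_eq_zero.1 h2.symm

/-- Without t-derivatives, integration by parts in x and y leaves order zero only. For x the
linearization of f, the coefficient ρ is the variational derivative of f in x and y. -/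
theorem exists_symbolRem_eq_single {x : MultiIndex →₀ DiffFun}
    (hx : ∀ α : MultiIndex, α 0 ≠ 0 → x α = 0) :
    ∃ ρ, symbolRem 1 (symbolRem 2 x) = Finsupp.single 0 ρ := by
  have h : symbolRem 1 (symbolRem 2 x)
      ∈ LinearMap.range (Finsupp.lsingle (R := ℝ) (M := DiffFun) (0 : MultiIndex)) := by
    rw [← Finsupp.sum_single x, Finsupp.sum, map_sum, map_sum]
    refine sum_mem fun α hα => ?_
    have hα0 : α 0 = 0 := by
      by_contra h
      exact Finsupp.mem_support_iff.1 hα (hx α h)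
    rw [symbolRem_single, symbolRem_single]
    have h0 : Function.update (Function.update α 2 0) 1 0 = 0 := by
      funext μ
      fin_cases μ <;> simp [hα0]
    rw [h0]
    exact ⟨_, rfl⟩
  obtain ⟨ρ, hρ⟩ := h
  exact ⟨ρ, hρ.symm⟩

theorem exists_eq_symbolRem_add (x : MultiIndex →₀ DiffFun) :
    ∃ y z, x = symbolRem 1 (symbolRem 2 x) + symbolD 1 y + symbolD 2 z := by
  obtain ⟨z, hz⟩ := sub_symbolRem_mem 2 x
  obtain ⟨y, hy⟩ := sub_symbolRem_mem 1 (symbolRem 2 x)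
  exact ⟨y, z, by rw [hy, hz]; abel⟩

theorem restrictSol_totalDiv (F : Current) : restrictSol (totalDiv F)
    = evolutionD (restrictSol (F 0)) + totalD 1 (restrictSol (F 1))
      + totalD 2 (restrictSol (F 2)) := by
  rw [totalDiv_apply, map_add, map_add, restrictSol_totalD, restrictSol_totalD, restrictSol_totalD]
  rfl

/-- The density of a conserved current, restricted to the solutions, is `γ u` up to a divergence
with respect to `x` and `y`. -/
theorem exists_density_eq {F : Current} (hF : F ∈ conservedCurrents) :
    ∃ (γ : backwardHeat) (A B : DiffFun), restrictSol (F 0)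
      = heatToDiffFun γ * jetVar ![0, 0, 0] + totalD 1 A + totalD 2 B := by
  have hfree := restrictSol_mem_freeFun (F 0)
  obtain ⟨ρ, hρ⟩ := exists_symbolRem_eq_single (x := vgrad (restrictSol (F 0)))
    fun α hα => hfree α hα
  have hρ0 : ρ ∈ freeFun := by
    have hN : ∀ μ : Fin 3, μ ≠ 0 → ∀ g ∈ Subalgebra.toSubmodule freeFun,
        totalD μ g ∈ Subalgebra.toSubmodule freeFun := fun μ hμ _ hg => totalD_mem_freeFun hμ hg
    have h := symbolRem_mem (hN 1 (by decide)) (symbolRem_mem (hN 2 (by decide))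
      (x := vgrad (restrictSol (F 0))) fun α => partialD_mem_freeFun _ hfree) 0
    rwa [hρ, Finsupp.single_eq_same] at h
  -- On the restricted density, D_t minus `evolutionD` is the linearization applied to L, that is,
  -- ρL plus divergences in x and y. Conservation turns the `evolutionD` term into divergences too,
  -- so moving all of them into the fluxes displays ρL as a total divergence.
  have hchar : ρ ∈ characteristics := by
    obtain ⟨y, z, hx⟩ := exists_eq_symbolRem_add (vgrad (restrictSol (F 0)))
    have h0 : restrictSol (totalDiv F) = 0 := mem_vanishing_iff.1 hF
    rw [restrictSol_totalDiv] at h0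
    have h1 := totalD_zero_sub_evolutionD (restrictSol (F 0))
    have ha : ∀ (μ : Fin 3) (α : MultiIndex), totalDIter (α + Pi.single μ 1) burgers
        = totalD μ (totalDIter α burgers) := fun μ α => totalDIter_add_single α μ burgers
    rw [hx, hρ, map_add, map_add, linearCombination_symbolD (ha 1),
      linearCombination_symbolD (ha 2), Finsupp.linearCombination_single, totalDIter_zero,
      smul_eq_mul] at h1
    refine ⟨![restrictSol (F 0),
      restrictSol (F 1) - Finsupp.linearCombination DiffFun (fun α => totalDIter α burgers) y,
      restrictSol (F 2) - Finsupp.linearCombination DiffFun (fun α => totalDIter α burgers) z], ?_⟩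
    rw [totalDiv_apply]
    simp only [Matrix.cons_val, map_sub, LinearMap.mulRight_apply]
    linear_combination h0 + h1
  obtain ⟨γ, hγ⟩ := exists_heatToDiffFun_eq_restrictSol (characteristics_le_cosymmetries hchar)
  rw [restrictSol_of_mem_freeFun hρ0] at hγ
  obtain ⟨A, B, hAB⟩ :=
    exists_eq_totalD_add (f := restrictSol (F 0) - heatToDiffFun γ * jetVar ![0, 0, 0]) (by
      rw [map_sub, map_sub, map_sub, hρ, vgrad_heatToDiffFun_mul, symbolRem_single_zero,
        symbolRem_single_zero, hγ, sub_self])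
  exact ⟨γ, A, B, by rw [add_assoc, ← hAB]; abel⟩

/-- The restriction of a current to the solutions. -/
def restrictCurrent (F : Current) : Current := fun μ => restrictSol (F μ)

theorem sub_restrictCurrent_mem (F : Current) : F - restrictCurrent F ∈ trivialCurrents :=
  Submodule.mem_sup_left fun μ _ => sub_restrictSol_mem (F μ)

theorem trivialCurrents_le_conservedCurrents : trivialCurrents ≤ conservedCurrents := by
  refine sup_le (fun V hV => ?_) fun K hK => ?_
  · change totalDiv V ∈ vanishing
    rw [totalDiv_apply]
    exact add_mem (add_mem (totalD_mem_vanishing 0 (hV 0 trivial))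
      (totalD_mem_vanishing 1 (hV 1 trivial))) (totalD_mem_vanishing 2 (hV 2 trivial))
  · change totalDiv K ∈ vanishing
    rw [LinearMap.mem_ker.1 hK]
    exact zero_mem _

/-- With zero density the restricted conservation law involves only D_x and D_y, which restriction
leaves unchanged. Thus it holds identically on the jet space, and the restricted current is a null
divergence. -/
theorem mem_trivialCurrents_of_restrictSol_eq_zero {F : Current} (hF : F ∈ conservedCurrents)
    (h0 : restrictSol (F 0) = 0) : F ∈ trivialCurrents := by
  have h := restrictSol_totalDiv F
  rw [mem_vanishing_iff.1 hF, h0, map_zero, zero_add] at h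
  have h1 : restrictCurrent F ∈ trivialCurrents := by
    refine Submodule.mem_sup_right (LinearMap.mem_ker.2 ?_)
    rw [totalDiv_apply]
    simp only [restrictCurrent, h0, map_zero, zero_add, ← h]
  simpa using add_mem (sub_restrictCurrent_mem F) h1

theorem exists_sub_heatCurrent_mem {F : Current} (hF : F ∈ conservedCurrents) :
    ∃ γ, F - heatCurrent γ ∈ trivialCurrents := by
  obtain ⟨γ, A, B, h⟩ := exists_density_eq hF
  -- The null divergence whose density is D_x A + D_y B, by commutativity of the total derivatives.
  have hN : (![totalD 1 A + totalD 2 B, -totalD 0 A, -totalD 0 B] : Current)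
      ∈ trivialCurrents := by
    refine Submodule.mem_sup_right (LinearMap.mem_ker.2 ?_)
    have h1 := LinearMap.congr_fun (totalD_comm 0 1).eq A
    have h2 := LinearMap.congr_fun (totalD_comm 0 2).eq B
    simp only [Module.End.mul_apply] at h1 h2
    rw [totalDiv_apply]
    simp only [Matrix.cons_val, map_add, map_neg, h1, h2]
    abel
  -- Passing to the restriction of F and removing this null divergence makes the density exactly
  -- zero.
  have hG : F - heatCurrent γ - (F - restrictCurrent F)
      - ![totalD 1 A + totalD 2 B, -totalD 0 A, -totalD 0 B] ∈ trivialCurrents := by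
    refine mem_trivialCurrents_of_restrictSol_eq_zero
      (sub_mem (sub_mem (sub_mem hF (heatCurrent_mem_conservedCurrents γ))
        (trivialCurrents_le_conservedCurrents (sub_restrictCurrent_mem F)))
        (trivialCurrents_le_conservedCurrents hN)) ?_
    have e : (F - heatCurrent γ - (F - restrictCurrent F)
        - ![totalD 1 A + totalD 2 B, -totalD 0 A, -totalD 0 B] : Current) 0 = 0 := by
      have h0 : heatCurrent γ 0 = heatToDiffFun γ * jetVar ![0, 0, 0] := rfl
      simp only [Pi.sub_apply, h0, restrictCurrent, h, Matrix.cons_val]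
      abel
    rw [e, map_zero]
  have h1 := add_mem (add_mem hG hN) (sub_restrictCurrent_mem F)
  rw [sub_add_cancel, sub_add_cancel] at h1
  exact ⟨γ, h1⟩

/-! ### Passage to the quotient spaces -/

theorem exists_linearEquiv_quotient {V A : Type*} [AddCommGroup V] [Module ℝ V] [AddCommGroup A]
    [Module ℝ A] (φ : V →ₗ[ℝ] A) (S N : Submodule ℝ A) (hS : ∀ v, φ v ∈ S)
    (hinj : ∀ v, φ v ∈ N → v = 0) (hsurj : ∀ a ∈ S, ∃ v, a - φ v ∈ N) :
    ∃ e : V ≃ₗ[ℝ] S ⧸ N.submoduleOf S, ∀ v, ∃ h : φ v ∈ S,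
      e v = Submodule.Quotient.mk ⟨φ v, h⟩ := by
  refine ⟨LinearEquiv.ofBijective ((N.submoduleOf S).mkQ ∘ₗ φ.codRestrict S hS) ⟨?_, ?_⟩,
    fun v => ⟨hS v, rfl⟩⟩
  · refine (injective_iff_map_eq_zero _).2 fun v hv => hinj v ?_
    exact (Submodule.Quotient.mk_eq_zero (N.submoduleOf S) (x := φ.codRestrict S hS v)).1 hv
  · intro q
    obtain ⟨⟨a, ha⟩, rfl⟩ := Submodule.mkQ_surjective _ q
    obtain ⟨v, hv⟩ := hsurj a ha
    refine ⟨v, ((Submodule.Quotient.eq _).2 ?_).symm⟩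
    exact hv

theorem eq_zero_of_heatToDiffFun_mem_vanishing {γ : backwardHeat}
    (h : heatToDiffFun γ ∈ vanishing) : γ = 0 := by
  refine heatToDiffFun_injective ?_
  rw [map_zero]
  exact eq_zero_of_mem_freeFun (heatToDiffFun_mem_freeFun γ) h

theorem exists_sub_heatToDiffFun_mem {f : DiffFun} (hf : f ∈ cosymmetries) :
    ∃ γ, f - heatToDiffFun γ ∈ vanishing := by
  obtain ⟨γ, hγ⟩ := exists_heatToDiffFun_eq_restrictSol hf
  exact ⟨γ, hγ ▸ sub_restrictSol_mem f⟩

end DegenerateBurgers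
end

open DegenerateBurgers in
theorem mainTheorem4 :
    (∃ e : backwardHeat ≃ₗ[ℝ] CosymmetryClasses, ∀ γ : backwardHeat,
      ∃ h : heatToDiffFun γ ∈ cosymmetries,
        e γ = Submodule.Quotient.mk ⟨heatToDiffFun γ, h⟩) ∧
    (∃ e : backwardHeat ≃ₗ[ℝ] CharacteristicClasses, ∀ γ : backwardHeat,
      ∃ h : heatToDiffFun γ ∈ characteristics,
        e γ = Submodule.Quotient.mk ⟨heatToDiffFun γ, h⟩) ∧
    (∃ e : heatCurrents ≃ₗ[ℝ] ConservationLaws, ∀ F : heatCurrents,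
      ∃ h : (F : Current) ∈ conservedCurrents,
        e F = Submodule.Quotient.mk ⟨(F : Current), h⟩) := by
  refine ⟨?_, ?_, ?_⟩
  · exact exists_linearEquiv_quotient heatToDiffFun _ _ heatToDiffFun_mem_cosymmetries
      (fun _ => eq_zero_of_heatToDiffFun_mem_vanishing) fun _ => exists_sub_heatToDiffFun_mem
  -- Characteristics lie between the heat solutions and the cosymmetries, so surjectivity is
  -- inherited from the cosymmetries.
  · exact exists_linearEquiv_quotient heatToDiffFun _ _ heatToDiffFun_mem_characteristics
      (fun _ => eq_zero_of_heatToDiffFun_mem_vanishing)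
      fun _ hf => exists_sub_heatToDiffFun_mem (characteristics_le_cosymmetries hf)
  · refine exists_linearEquiv_quotient heatCurrents.subtype _ _ ?_ ?_ ?_
    · rintro ⟨_, γ, rfl⟩
      exact heatCurrent_mem_conservedCurrents γ
    · rintro ⟨_, γ, rfl⟩ h
      obtain rfl := eq_zero_of_heatCurrent_mem_trivialCurrents h
      exact Subtype.ext (map_zero heatCurrent)
    · intro F hF
      obtain ⟨γ, hγ⟩ := exists_sub_heatCurrent_mem hF
      exact ⟨⟨heatCurrent γ, γ, rfl⟩, hγ⟩
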